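/- Let $n\ge 1$ and let $\mathbb H$ denote the quaternions. Regard $\mathbb H^{n}$ as a right $\mathbb H$-vector space, with $\langle z,w\rangle=\sum_{i}\overline{w_i}z_i$ and $|z|^2=\langle z,z\rangle$, and let $B=B_{\mathbb H}^n=\{z\in\mathbb H^n:|z|<1\}$. On $\mathbb H^{n+1}$ put $\langle \mathbf z,\mathbf w\rangle=\mathbf w^*J\mathbf z$ with $J=\mathrm{diag}(1,\dots,1,-1)$. Define: - the Bergman distance $d_H$ on $B$ by $\cosh^2\frac{d_H(z,w)}2=\dfrac{\langle\mathbf z,\mathbf w\rangle\langle\mathbf w,\mathbf z\rangle}{\langle\mathbf z,\mathbf z\rangle\langle\mathbf w,\mathbf w\rangle}$, where $\mathbf z=(z,1)^{\mathrm t}$, $\mathbf w=(w,1)^{\mathrm t}$ and $d_H\ge 0$; - the hyperbolic measure $d\Lambda(q)=\dfrac{4^{2n}\,d\lambda(q)}{(1-|q|^2)^{2n+2}}$ on $B$, where $\lambda$ is Lebesgue measure on $\mathbb H^n\cong\mathbb R^{4n}$; - for $u\in B$ the Hua involution $\Phi_u(z)=(u-A_uz)(1-\langle z,u\rangle)^{-1}$,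 where $A_u=\frac1{1+s}uu^*+sI_n$ and $s=\sqrt{1-|u|^2}$; - the group $\mathrm{Sp}(n,1)=\{g\in \mathrm{GL}(n+1,\mathbb H): g^*Jg=J\}$, acting on $B$ by $g(z)=(Az+\alpha)(\beta z+a)^{-1}$ for $g=\begin{pmatrix}A&\alpha\\ \beta&a\end{pmatrix}$. Call $D\subseteq B$ admissible if it is measurable, $0<\Lambda(D)<\infty$ and $\int_D d_H(0,y)\,d\Lambda(y)<\infty$. Let $D$ be admissible. Then the following hold. (i) For every $c\in B$ the map $\Phi_c$ is $\Lambda$-integrable on $D$, and there is a unique $c=c(D)\in B$ such that $\int_D\Phi_c(q)\,d\Lambda(q)=0$. (ii) For every $x\in B$ the function $y\mapsto\log\cosh^2\bigl(\tfrac12d_H(x,y)\bigr)$ is $\Lambda$-integrable on $D$. The energy $G(x)=\int_D\log\cosh^2\bigl(\tfrac12d_H(x,y)\bigr)\,d\Lambda(y)$ is strictly geodesically convex on $B$: for all $a<b$ and every $\gamma:[a,b]\to B$ with $d_H(\gamma(s),\gamma(t))=|s-t|$ for all $s,t$, the function $G\circ\gamma$ is strictly convex. The point $c(D)$ is the unique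 global minimiser of $G$ on $B$, that is, $G(c(D))<G(x)$ for every $x\in B$ with $x\ne c(D)$. (iii) For every $g\in\mathrm{Sp}(n,1)$ the set $g(D)$ is admissible and $c(g(D))=g(c(D))$. -/

import Mathlib

open MeasureTheory
open scoped Quaternion Matrix

noncomputable section

namespace QHyp

/-- The Borel sigma-algebra on the real quaternions. -/
instance instMeasurableSpaceQuaternion : MeasurableSpace ℍ[ℝ] := borel ℍ[ℝ]

instance instBorelSpaceQuaternion : BorelSpace ℍ[ℝ] := ⟨rfl⟩

/-- The space of columns of `n` quaternions, with norm `|z| = sqrt (|z₁|² + ⋯ + |zₙ|²)`; as a real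
vector space it is Euclidean space of dimension `4n`, and its `volume` is Lebesgue measure. -/
abbrev HSpace (n : ℕ) : Type := EuclideanSpace ℍ[ℝ] (Fin n)

/-- The quaternionic unit ball: `|z₁|² + ⋯ + |zₙ|² < 1`. -/
def ball (n : ℕ) : Set (HSpace n) := {z | ∑ i, ‖z i‖ ^ 2 < 1}

/-- Columns of `n + 1` quaternions; `Sum.inr ()` is the index of the last entry. -/
abbrev Hn1 (n : ℕ) : Type := Fin n ⊕ Unit → ℍ[ℝ]

/-- The matrix `diag (1, …, 1, -1)`. -/
def sigJ (n : ℕ) : Matrix (Fin n ⊕ Unit) (Fin n ⊕ Unit) ℍ[ℝ] :=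
  Matrix.fromBlocks 1 0 0 (-1)

/-- The Hermitian form `⟨z, w⟩ = w* J z` of signature `(n, 1)`. -/
def herm {n : ℕ} (z w : Hn1 n) : ℍ[ℝ] := star w ⬝ᵥ (sigJ n *ᵥ z)

/-- The standard lift `(z₁, …, zₙ, 1)`. -/
def lift {n : ℕ} (z : HSpace n) : Hn1 n := Sum.elim (fun i => z i) (fun _ => 1)

/-- The projection `(z₁, …, zₙ₊₁) ↦ (z₁ zₙ₊₁⁻¹, …, zₙ zₙ₊₁⁻¹)`. -/
def proj {n : ℕ} (v : Hn1 n) : HSpace n :=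
  WithLp.toLp 2 fun i => v (Sum.inl i) * (v (Sum.inr ()))⁻¹

/-- The group `Sp(n, 1)` of invertible quaternionic matrices `A` with `A* J A = J`. -/
def Sp (n : ℕ) : Subgroup (Matrix (Fin n ⊕ Unit) (Fin n ⊕ Unit) ℍ[ℝ])ˣ where
  carrier := {A | A.valᴴ * sigJ n * A.val = sigJ n}
  one_mem' := by simp
  mul_mem' := by
    intro A B hA hB
    simp only [Set.mem_ofPred_eq] at hA hB ⊢
    calc (A * B).valᴴ * sigJ n * (A * B).val
        = B.valᴴ * (A.valᴴ * sigJ n * A.val) * B.val := by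
          simp only [Units.val_mul, Matrix.conjTranspose_mul, Matrix.mul_assoc]
      _ = sigJ n := by rw [hA, hB]
  inv_mem' := by
    intro A hA
    simp only [Set.mem_ofPred_eq] at hA ⊢
    have h1 : A.val * (A⁻¹).val = 1 := A.mul_inv
    have h2 : (A⁻¹).valᴴ * A.valᴴ = 1 := by
      rw [← Matrix.conjTranspose_mul, h1, Matrix.conjTranspose_one]
    calc (A⁻¹).valᴴ * sigJ n * (A⁻¹).val
        = (A⁻¹).valᴴ * (A.valᴴ * sigJ n * A.val) * (A⁻¹).val := by rw [hA]
      _ = ((A⁻¹).valᴴ * A.valᴴ) * sigJ n * (A.val * (A⁻¹).val) := by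
          simp only [Matrix.mul_assoc]
      _ = sigJ n := by rw [h1, h2, Matrix.one_mul, Matrix.mul_one]

/-- The projective action `g(z) = (A z + α) (β z + a)⁻¹` of a block matrix
`g = (A, α; β, a)` on the ball. -/
def act {n : ℕ} (g : Sp n) (z : HSpace n) : HSpace n := proj (g.val.val *ᵥ lift z)

/-- The Bergman distance, determined by
`cosh² (d(z, w) / 2) = ⟨z, w⟩ ⟨w, z⟩ / (⟨z, z⟩ ⟨w, w⟩)` on lifts of `z` and `w`
(numerator and denominator are real quaternions). -/
def dH {n : ℕ} (z w : HSpace n) : ℝ :=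
  2 * Real.arcosh (Real.sqrt
    ((herm (lift z) (lift w) * herm (lift w) (lift z)).re /
      (herm (lift z) (lift z) * herm (lift w) (lift w)).re))

/-- The hyperbolic measure `4^(2n) dλ(q) / (1 - |q|²)^(2n+2)` on the unit ball. -/
def Lam (n : ℕ) : Measure (HSpace n) :=
  (volume.restrict (ball n)).withDensity fun q =>
    ENNReal.ofReal (4 ^ (2 * n) / (1 - ‖q‖ ^ 2) ^ (2 * n + 2))

/-- The matrix `A_u = (1 + s)⁻¹ u u* + s I`, where `s = sqrt (1 - |u|²)`. -/
def huaMatrix {n : ℕ} (u : HSpace n) : Matrix (Fin n) (Fin n) ℍ[ℝ] :=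
  (1 / (1 + Real.sqrt (1 - ‖u‖ ^ 2))) • Matrix.vecMulVec (fun i => u i) (fun i => star (u i))
    + Real.sqrt (1 - ‖u‖ ^ 2) • (1 : Matrix (Fin n) (Fin n) ℍ[ℝ])

/-- The quaternionic Hua involution `Φ_u(z) = (u - A_u z) (1 - ⟨z, u⟩)⁻¹`, where
`⟨z, u⟩ = ∑ i, conj (u i) * z i`. -/
def Phi {n : ℕ} (u z : HSpace n) : HSpace n :=
  WithLp.toLp 2 fun i =>
    (u i - (huaMatrix u *ᵥ fun j => z j) i) * (1 - ∑ j, star (u j) * z j)⁻¹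

/-- The sets under consideration: (Lebesgue) measurable subsets of the ball with
`0 < Λ(D) < ∞` and finite first moment `∫_D d(0, y) dΛ(y) < ∞`. -/
structure Admissible {n : ℕ} (D : Set (HSpace n)) : Prop where
  subset_ball : D ⊆ ball n
  measurable : NullMeasurableSet D (volume : Measure (HSpace n))
  pos : 0 < Lam n D
  finite : Lam n D < ⊤
  moment : IntegrableOn (fun y => dH 0 y) D (Lam n)

/-- `c` is a quaternionic conformal barycenter of `D`: a point of the ball with
`∫_D Φ_c dΛ = 0`. -/
def IsBarycenter {n : ℕ} (D : Set (HSpace n)) (c : HSpace n) : Prop :=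
  c ∈ ball n ∧ ∫ q in D, Phi c q ∂(Lam n) = 0

/-- The integrand `log cosh² (d(x, y) / 2)` of the energy. -/
def energyDensity {n : ℕ} (x y : HSpace n) : ℝ :=
  Real.log (Real.cosh (dH x y / 2) ^ 2)

/-- The energy functional `G(x) = ∫_D log cosh² (d(x, y) / 2) dΛ(y)`. -/
def energy {n : ℕ} (D : Set (HSpace n)) (x : HSpace n) : ℝ :=
  ∫ y in D, energyDensity x y ∂(Lam n)

/-- `γ` restricts to a geodesic segment `[a, b] → ball`, parametrised by arc length. The ball is a
Hadamard manifold, so its geodesics are exactly the curves that realise the distance. -/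
def IsGeodesicSegment {n : ℕ} (γ : ℝ → HSpace n) (a b : ℝ) : Prop :=
  (∀ t ∈ Set.Icc a b, γ t ∈ ball n) ∧
    ∀ s ∈ Set.Icc a b, ∀ t ∈ Set.Icc a b, dH (γ s) (γ t) = |s - t|

/-- A function on the ball is strictly geodesically convex if it is strictly convex along every
nonconstant geodesic segment. -/
def StrictGeodesicallyConvex {n : ℕ} (f : HSpace n → ℝ) : Prop :=
  ∀ (γ : ℝ → HSpace n) (a b : ℝ), a < b → IsGeodesicSegment γ a b →
    StrictConvexOn ℝ (Set.Icc a b) (f ∘ γ)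

end QHyp

end

/-! The energy density is `log (coshSq x y)`, and `coshSq` is invariant under `Sp(n, 1)` because it
is built from the Hermitian form. Hua involutions belong to the group and carry any point of the
ball to the origin, so everything reduces to rays from the origin. Along such a ray with unit
direction `e`, the density is, up to an additive constant, the logarithm of `A eᵗ + B e⁻ᵗ + C` with
positive weights of sum 1 and `A - B = -⟪e, y⟫` (`exists_energyDensity_ray_eq`). Such a function is
strictly convex and lies strictly above its tangent at `t = 0`.

Convexity of the energy follows by integration, since every geodesic segment is a Hua image of a
piece of a ray (`IsGeodesicSegment.exists_eq_ray`). Integrating the tangent inequality based at `c`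
gives a linear term `t ⟪e, ∫ Φ_c⟫`, which vanishes at a barycenter; hence a barycenter is the strict
global minimiser, and in particular unique. Conversely, `log u ≤ u - 1` gives an upper bound with
the same linear term and a quadratic error, so a minimiser is a barycenter
(`Admissible.isBarycenter_of_isMinOn`). A minimiser exists because the energy is continuous and
tends to infinity at the boundary.

Equivariance then needs only invariance of the energy under moving `D` and `x` together, which rests
on the invariance of the density and of the measure `Lam n`. The latter is a Jacobian computation
(`abs_det_fderiv_act`). -/

noncomputable section

namespace QHyp

variable {n : ℕ}

/-! ### Inner product, Hermitian form and the formula for the distance -/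

/-- The quaternionic inner product `∑ i, conj (w i) * z i`. -/
def ip (z w : HSpace n) : ℍ[ℝ] := ∑ j, star (w j) * z j

theorem mem_ball_iff {z : HSpace n} : z ∈ ball n ↔ ‖z‖ < 1 := by
  have h : ∑ i, ‖z i‖ ^ 2 = ‖z‖ ^ 2 := (PiLp.norm_sq_eq_of_L2 _ z).symm
  rw [ball, Set.mem_ofPred_eq, h, sq_lt_one_iff₀ (norm_nonneg z)]

theorem ball_eq : ball n = Metric.ball (0 : HSpace n) 1 := by
  ext z
  rw [mem_ball_iff, mem_ball_zero_iff]

theorem zero_mem_ball : (0 : HSpace n) ∈ ball n := by simp [mem_ball_iff]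

theorem one_sub_sq_pos {z : HSpace n} (hz : z ∈ ball n) : 0 < 1 - ‖z‖ ^ 2 := by
  rw [mem_ball_iff] at hz
  nlinarith [norm_nonneg z]

theorem quat_norm_sq (a : ℍ[ℝ]) : ‖a‖ ^ 2 = Quaternion.normSq a := by
  rw [sq, Quaternion.normSq_eq_norm_mul_self]

theorem ip_self (z : HSpace n) : ip z z = ((‖z‖ ^ 2 : ℝ) : ℍ[ℝ]) := by
  have h : ‖z‖ ^ 2 = ∑ i, ‖z i‖ ^ 2 := PiLp.norm_sq_eq_of_L2 _ z
  rw [ip, h]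
  simp only [Quaternion.star_mul_self, quat_norm_sq]
  exact (map_sum (algebraMap ℝ ℍ[ℝ]) _ _).symm

theorem star_ip (z w : HSpace n) : star (ip z w) = ip w z := by
  simp [ip, star_sum]

theorem ip_re (z w : HSpace n) : (ip z w).re = inner ℝ z w := by
  have hre : (ip z w).re = ∑ j, (star (w j) * z j).re :=
    map_sum (AddMonoidHom.mk' (fun q : ℍ[ℝ] => q.re) (fun _ _ => rfl)) _ _
  rw [hre, PiLp.inner_apply]
  refine Finset.sum_congr rfl fun j _ => ?_
  rw [Quaternion.inner_def]
  simp
  ring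

theorem norm_ip_le (z w : HSpace n) : ‖ip z w‖ ≤ ‖z‖ * ‖w‖ := by
  have h1 : ‖ip z w‖ ≤ ∑ j, ‖z j‖ * ‖w j‖ := by
    refine (norm_sum_le _ _).trans_eq (Finset.sum_congr rfl fun j _ => ?_)
    rw [norm_mul, norm_star, mul_comm]
  refine h1.trans ?_
  have h2 := Real.sum_mul_le_sqrt_mul_sqrt Finset.univ (fun j => ‖z j‖) (fun j => ‖w j‖)
  have hz : ‖z‖ ^ 2 = ∑ i, ‖z i‖ ^ 2 := PiLp.norm_sq_eq_of_L2 _ z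
  have hw : ‖w‖ ^ 2 = ∑ i, ‖w i‖ ^ 2 := PiLp.norm_sq_eq_of_L2 _ w
  rwa [← hz, ← hw, Real.sqrt_sq (norm_nonneg _), Real.sqrt_sq (norm_nonneg _)] at h2

theorem ip_smul_left (r : ℝ) (z w : HSpace n) : ip (r • z) w = r • ip z w := by
  simp [ip, Finset.smul_sum]

@[simp] theorem ip_zero_left (w : HSpace n) : ip 0 w = 0 := by simp [ip]

theorem herm_eq (v w : Hn1 n) :
    herm v w = ∑ j, star (w (Sum.inl j)) * v (Sum.inl j) - star (w (Sum.inr ())) * v (Sum.inr ()) := by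
  have h : sigJ n *ᵥ v = Sum.elim (fun i => v (Sum.inl i)) (fun _ => - v (Sum.inr ())) := by
    rw [sigJ, Matrix.fromBlocks_mulVec]
    ext1 i
    rcases i with i | i <;> simp [Matrix.neg_mulVec]
  rw [herm, h]
  simp [dotProduct, sub_eq_add_neg]

theorem herm_lift (z w : HSpace n) : herm (lift z) (lift w) = ip z w - 1 := by
  simp [herm_eq, lift, ip]

theorem herm_smul (v w : Hn1 n) (a b : ℍ[ℝ]) :
    herm (fun i => v i * a) (fun i => w i * b) = star b * herm v w * a := by
  simp [herm_eq, mul_sub, sub_mul, Finset.mul_sum, Finset.sum_mul, mul_assoc]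

theorem herm_mulVec (g : Sp n) (v w : Hn1 n) :
    herm (g.val.val *ᵥ v) (g.val.val *ᵥ w) = herm v w := by
  have hg : g.val.valᴴ * sigJ n * g.val.val = sigJ n := g.2
  rw [herm, herm, Matrix.star_mulVec, ← Matrix.dotProduct_mulVec, Matrix.mulVec_mulVec,
    Matrix.mulVec_mulVec, hg]

/-- The quantity `|⟨z, w⟩|² / (⟨z, z⟩ ⟨w, w⟩)`, equal to `cosh² (d(z, w) / 2)` on the ball. -/
def coshSq (z w : HSpace n) : ℝ := ‖1 - ip z w‖ ^ 2 / ((1 - ‖z‖ ^ 2) * (1 - ‖w‖ ^ 2))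

theorem herm_mul_herm (v w : Hn1 n) : herm v w * herm w v = ((‖herm v w‖ ^ 2 : ℝ) : ℍ[ℝ]) := by
  have : herm w v = star (herm v w) := by simp [herm_eq, star_sum]
  rw [this, Quaternion.self_mul_star, quat_norm_sq]

theorem herm_self_lift (z : HSpace n) : herm (lift z) (lift z) = ((‖z‖ ^ 2 - 1 : ℝ) : ℍ[ℝ]) := by
  rw [herm_lift, ip_self]; simp

theorem dH_eq (z w : HSpace n) : dH z w = 2 * Real.arcosh (Real.sqrt (coshSq z w)) := by
  rw [dH, herm_mul_herm, herm_self_lift, herm_self_lift, ← Quaternion.coe_mul, Quaternion.re_coe,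
    Quaternion.re_coe, herm_lift, coshSq, norm_sub_rev]
  congr 4
  ring

theorem one_sub_norm_ip_le (z w : HSpace n) : 1 - ‖z‖ * ‖w‖ ≤ ‖1 - ip z w‖ := by
  have := norm_sub_norm_le (1 : ℍ[ℝ]) (ip z w)
  have h2 := norm_ip_le z w
  rw [norm_one] at this
  linarith

theorem norm_mul_lt_one {z w : HSpace n} (hz : z ∈ ball n) (hw : w ∈ ball n) :
    ‖z‖ * ‖w‖ < 1 := by
  rw [mem_ball_iff] at hz hw
  nlinarith [norm_nonneg z, norm_nonneg w]

theorem norm_one_sub_ip_pos {z w : HSpace n} (hz : z ∈ ball n) (hw : w ∈ ball n) :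
    0 < ‖1 - ip z w‖ := by
  linarith [one_sub_norm_ip_le z w, norm_mul_lt_one hz hw]

theorem norm_one_sub_ip_le_two {z w : HSpace n} (hz : z ∈ ball n) (hw : w ∈ ball n) :
    ‖1 - ip z w‖ ≤ 2 := by
  have := norm_sub_le (1 : ℍ[ℝ]) (ip z w)
  rw [norm_one] at this
  linarith [norm_ip_le z w, norm_mul_lt_one hz hw]

/-- A reverse Cauchy–Schwarz inequality: with `a = ‖z‖`, `b = ‖w‖`, one has `(1 - ab)² - (1 - a²)(1
- b²) = (a - b)²`. -/
theorem one_le_coshSq {z w : HSpace n} (hz : z ∈ ball n) (hw : w ∈ ball n) : 1 ≤ coshSq z w := by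
  rw [coshSq, one_le_div (mul_pos (one_sub_sq_pos hz) (one_sub_sq_pos hw))]
  have h := one_sub_norm_ip_le z w
  have h1 := norm_mul_lt_one hz hw
  have h2 : (1 - ‖z‖ * ‖w‖) ^ 2 ≤ ‖1 - ip z w‖ ^ 2 := pow_le_pow_left₀ (by linarith) h 2
  nlinarith [sq_nonneg (‖z‖ - ‖w‖)]

theorem cosh_sq_dH {z w : HSpace n} (hz : z ∈ ball n) (hw : w ∈ ball n) :
    Real.cosh (dH z w / 2) ^ 2 = coshSq z w := by
  have h := one_le_coshSq hz hw
  rw [dH_eq, mul_div_cancel_left₀ _ (two_ne_zero), Real.cosh_arcosh (Real.one_le_sqrt.2 h),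
    Real.sq_sqrt (by linarith)]

theorem dH_nonneg {z w : HSpace n} (hz : z ∈ ball n) (hw : w ∈ ball n) : 0 ≤ dH z w := by
  rw [dH_eq]
  have := Real.arcosh_nonneg (Real.one_le_sqrt.2 (one_le_coshSq hz hw))
  linarith

theorem energyDensity_eq_log {x y : HSpace n} (hx : x ∈ ball n) (hy : y ∈ ball n) :
    energyDensity x y = Real.log (coshSq x y) := by
  rw [energyDensity, cosh_sq_dH hx hy]

theorem energyDensity_eq {x y : HSpace n} (hx : x ∈ ball n) (hy : y ∈ ball n) :
    energyDensity x y =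
      2 * Real.log ‖1 - ip x y‖ - Real.log (1 - ‖x‖ ^ 2) - Real.log (1 - ‖y‖ ^ 2) := by
  have h1 := (one_sub_sq_pos hx)
  have h2 := (one_sub_sq_pos hy)
  have h3 := norm_one_sub_ip_pos hx hy
  rw [energyDensity_eq_log hx hy, coshSq, Real.log_div (by positivity) (by positivity),
    Real.log_mul h1.ne' h2.ne', Real.log_pow]
  push_cast
  ring

theorem energyDensity_nonneg {x y : HSpace n} (hx : x ∈ ball n) (hy : y ∈ ball n) :
    0 ≤ energyDensity x y := by
  rw [energyDensity_eq_log hx hy]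
  exact Real.log_nonneg (one_le_coshSq hx hy)

theorem energyDensity_le_dH {x y : HSpace n} (hx : x ∈ ball n) (hy : y ∈ ball n) :
    energyDensity x y ≤ dH x y := by
  have h := dH_nonneg hx hy
  rw [energyDensity, Real.log_pow]
  have h1 : Real.log (Real.cosh (dH x y / 2)) ≤ dH x y / 2 := by
    rw [Real.log_le_iff_le_exp (Real.cosh_pos _), Real.cosh_eq]
    have : Real.exp (-(dH x y / 2)) ≤ Real.exp (dH x y / 2) := Real.exp_le_exp.2 (by linarith)
    linarith
  push_cast
  linarith

/-- From `cosh s ≥ eˢ / 2`. Together with `energyDensity_le_dH` it makes the first-moment condition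
interchangeable with integrability of the energy density. -/
theorem dH_le_energyDensity {x y : HSpace n} :
    dH x y ≤ energyDensity x y + 2 * Real.log 2 := by
  rw [energyDensity, Real.log_pow]
  have h1 : dH x y / 2 ≤ Real.log 2 + Real.log (Real.cosh (dH x y / 2)) := by
    rw [← Real.log_mul two_ne_zero (Real.cosh_pos _).ne', Real.le_log_iff_exp_le
      (by linarith [Real.cosh_pos (dH x y / 2)]), Real.cosh_eq]
    linarith [Real.exp_pos (-(dH x y / 2))]
  push_cast
  linarith

/-! ### The action of `Sp(n, 1)` on the ball -/

theorem last_ne_zero_of_herm_neg {v : Hn1 n} (hv : (herm v v).re < 0) : v (Sum.inr ()) ≠ 0 := by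
  intro h
  have h1 : herm v v = ip (WithLp.toLp 2 fun i => v (Sum.inl i)) (WithLp.toLp 2 fun i => v (Sum.inl i)) := by
    simp [herm_eq, h, ip]
  rw [h1, ip_self, Quaternion.re_coe] at hv
  exact absurd hv (not_lt.2 (by positivity))

theorem lift_proj {v : Hn1 n} (hv : v (Sum.inr ()) ≠ 0) :
    lift (proj v) = fun i => v i * (v (Sum.inr ()))⁻¹ := by
  ext1 i
  rcases i with i | i
  · simp [lift, proj]
  · simp [lift, hv]

theorem proj_lift (z : HSpace n) : proj (lift z) = z := by
  ext1 i
  simp [lift, proj]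

theorem proj_mul_right (v : Hn1 n) {a : ℍ[ℝ]} (ha : a ≠ 0) : proj (fun i => v i * a) = proj v := by
  ext1 i
  simp only [proj, mul_inv_rev, mul_assoc, mul_inv_cancel_left₀ ha]

theorem mulVec_mul_right (M : Matrix (Fin n ⊕ Unit) (Fin n ⊕ Unit) ℍ[ℝ]) (v : Hn1 n) (a : ℍ[ℝ]) :
    M *ᵥ (fun i => v i * a) = fun i => (M *ᵥ v) i * a := by
  ext1 i
  simp only [Matrix.mulVec, dotProduct, Finset.sum_mul, mul_assoc]

theorem herm_mulVec_lift_neg (g : Sp n) {z : HSpace n} (hz : z ∈ ball n) :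
    (herm (g.val.val *ᵥ lift z) (g.val.val *ᵥ lift z)).re < 0 := by
  rw [herm_mulVec, herm_self_lift, Quaternion.re_coe]
  linarith [one_sub_sq_pos hz]

theorem last_mulVec_lift_ne_zero (g : Sp n) {z : HSpace n} (hz : z ∈ ball n) :
    (g.val.val *ᵥ lift z) (Sum.inr ()) ≠ 0 :=
  last_ne_zero_of_herm_neg (herm_mulVec_lift_neg g hz)

/-- The lift of `act g z` is `g` applied to the lift of `z`, divided on the right by its last entry;
the form is invariant, so only these last entries appear as factors. -/
theorem one_sub_ip_act (g : Sp n) {z w : HSpace n} (hz : z ∈ ball n) (hw : w ∈ ball n) :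
    1 - ip (act g z) (act g w) = star ((g.val.val *ᵥ lift w) (Sum.inr ()))⁻¹ * (1 - ip z w) *
      ((g.val.val *ᵥ lift z) (Sum.inr ()))⁻¹ := by
  have h := herm_lift (act g z) (act g w)
  rw [act, act, lift_proj (last_mulVec_lift_ne_zero g hz), lift_proj (last_mulVec_lift_ne_zero g hw),
    herm_smul, herm_mulVec, herm_lift, ← act, ← act] at h
  rw [← neg_sub (ip (act g z) _), ← h, ← neg_sub (ip z w), mul_neg, neg_mul]

theorem one_sub_norm_sq_act (g : Sp n) {z : HSpace n} (hz : z ∈ ball n) :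
    1 - ‖act g z‖ ^ 2 = (1 - ‖z‖ ^ 2) / ‖(g.val.val *ᵥ lift z) (Sum.inr ())‖ ^ 2 := by
  have h := one_sub_ip_act g hz hz
  set a := (g.val.val *ᵥ lift z) (Sum.inr ())
  rw [ip_self, ip_self, ← Quaternion.coe_one, ← Quaternion.coe_sub, ← Quaternion.coe_sub,
    mul_assoc, (Quaternion.coe_commute _ _).eq, ← mul_assoc, Quaternion.star_mul_self,
    ← Quaternion.coe_mul, Quaternion.coe_inj, ← quat_norm_sq] at h
  rw [h, norm_inv]
  ring

theorem act_mem_ball (g : Sp n) {z : HSpace n} (hz : z ∈ ball n) : act g z ∈ ball n := by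
  have h := one_sub_norm_sq_act g hz
  have h1 : 0 < 1 - ‖act g z‖ ^ 2 := by
    rw [h]
    have := norm_pos_iff.2 (last_mulVec_lift_ne_zero g hz)
    have := one_sub_sq_pos hz
    positivity
  rw [mem_ball_iff]
  nlinarith [norm_nonneg (act g z)]

theorem coshSq_act (g : Sp n) {z w : HSpace n} (hz : z ∈ ball n) (hw : w ∈ ball n) :
    coshSq (act g z) (act g w) = coshSq z w := by
  have h1 := norm_pos_iff.2 (last_mulVec_lift_ne_zero g hz)
  have h2 := norm_pos_iff.2 (last_mulVec_lift_ne_zero g hw)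
  have h3 := one_sub_sq_pos hz
  have h4 := one_sub_sq_pos hw
  rw [coshSq, coshSq, one_sub_norm_sq_act g hz, one_sub_norm_sq_act g hw, one_sub_ip_act g hz hw,
    norm_mul, norm_mul, norm_star, norm_inv, norm_inv]
  field_simp

theorem energyDensity_act (g : Sp n) {z w : HSpace n} (hz : z ∈ ball n) (hw : w ∈ ball n) :
    energyDensity (act g z) (act g w) = energyDensity z w := by
  rw [energyDensity_eq_log hz hw, energyDensity_eq_log (act_mem_ball g hz) (act_mem_ball g hw),
    coshSq_act g hz hw]

theorem dH_act (g : Sp n) {z w : HSpace n} (hz : z ∈ ball n) (hw : w ∈ ball n) :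
    dH (act g z) (act g w) = dH z w := by
  rw [dH_eq, dH_eq, coshSq_act g hz hw]

theorem act_mul (g h : Sp n) {z : HSpace n} (hz : z ∈ ball n) :
    act (g * h) z = act g (act h z) := by
  have h1 := last_mulVec_lift_ne_zero h hz
  rw [act, act, act, lift_proj h1, mulVec_mul_right, proj_mul_right _ (inv_ne_zero h1),
    Matrix.mulVec_mulVec]
  rfl

theorem act_one (z : HSpace n) : act 1 z = z := by
  rw [act]
  simp [proj_lift]

theorem act_inv_act (g : Sp n) {z : HSpace n} (hz : z ∈ ball n) : act g⁻¹ (act g z) = z := by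
  rw [← act_mul _ _ hz, inv_mul_cancel, act_one]

theorem act_act_inv (g : Sp n) {z : HSpace n} (hz : z ∈ ball n) : act g (act g⁻¹ z) = z := by
  rw [← act_mul _ _ hz, mul_inv_cancel, act_one]

/-! ### Hua involutions as elements of `Sp(n, 1)` -/

/-- A vector as a one-column matrix. -/
def colMat (u : HSpace n) : Matrix (Fin n) Unit ℍ[ℝ] := Matrix.of fun i _ => u i

theorem colMat_mul_conjTranspose (u : HSpace n) :
    colMat u * (colMat u)ᴴ = Matrix.vecMulVec (fun i => u i) (fun i => star (u i)) := by
  ext1 i j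
  simp [colMat, Matrix.mul_apply, Matrix.vecMulVec]

theorem conjTranspose_mul_colMat (u : HSpace n) :
    (colMat u)ᴴ * colMat u = (‖u‖ ^ 2) • (1 : Matrix Unit Unit ℍ[ℝ]) := by
  ext1 i j
  have := ip_self u
  rw [ip] at this
  simp only [colMat, Matrix.mul_apply, Matrix.conjTranspose_apply, Matrix.of_apply, this]
  rw [Matrix.smul_apply, Matrix.one_apply_eq, ← Quaternion.coe_mul_eq_smul, mul_one]

theorem huaMatrix_eq (u : HSpace n) : huaMatrix u =
    (1 / (1 + Real.sqrt (1 - ‖u‖ ^ 2))) • (colMat u * (colMat u)ᴴ) + Real.sqrt (1 - ‖u‖ ^ 2) • 1 := by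
  rw [colMat_mul_conjTranspose, huaMatrix]

theorem conjTranspose_real_smul {l m : Type*} (r : ℝ) (M : Matrix l m ℍ[ℝ]) :
    (r • M)ᴴ = r • Mᴴ := by
  ext1 i j
  simp only [Matrix.conjTranspose_apply, Matrix.smul_apply, Quaternion.star_smul]

theorem conjTranspose_huaMatrix (u : HSpace n) : (huaMatrix u)ᴴ = huaMatrix u := by
  rw [huaMatrix_eq, Matrix.conjTranspose_add, conjTranspose_real_smul, conjTranspose_real_smul,
    Matrix.conjTranspose_mul, Matrix.conjTranspose_conjTranspose, Matrix.conjTranspose_one]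

theorem sqrt_one_sub_sq_pos {u : HSpace n} (hu : u ∈ ball n) : 0 < Real.sqrt (1 - ‖u‖ ^ 2) :=
  Real.sqrt_pos.2 (one_sub_sq_pos hu)

theorem norm_sq_eq_sqrt {u : HSpace n} (hu : u ∈ ball n) :
    ‖u‖ ^ 2 = 1 - Real.sqrt (1 - ‖u‖ ^ 2) ^ 2 := by
  rw [Real.sq_sqrt (one_sub_sq_pos hu).le]; ring

theorem huaMatrix_mul_colMat {u : HSpace n} (hu : u ∈ ball n) : huaMatrix u * colMat u = colMat u := by
  have h1 := sqrt_one_sub_sq_pos hu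
  have h2 := norm_sq_eq_sqrt hu
  rw [huaMatrix_eq]
  set s := Real.sqrt (1 - ‖u‖ ^ 2)
  rw [Matrix.add_mul, Matrix.smul_mul, Matrix.mul_assoc, conjTranspose_mul_colMat, Matrix.smul_mul,
    Matrix.one_mul, Matrix.mul_smul, Matrix.mul_one, smul_smul, ← add_smul, h2]
  have : 1 / (1 + s) * (1 - s ^ 2) + s = 1 := by field_simp; ring
  rw [this, one_smul]

theorem huaMatrix_mul_self {u : HSpace n} (hu : u ∈ ball n) :
    huaMatrix u * huaMatrix u = colMat u * (colMat u)ᴴ + (1 - ‖u‖ ^ 2) • 1 := by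
  have h1 := sqrt_one_sub_sq_pos hu
  have h2 := norm_sq_eq_sqrt hu
  have h4 : huaMatrix u * huaMatrix u = ((1 / (1 + Real.sqrt (1 - ‖u‖ ^ 2))) •
      (colMat u * (colMat u)ᴴ) + Real.sqrt (1 - ‖u‖ ^ 2) • 1) * huaMatrix u := by
    rw [← huaMatrix_eq]
  rw [h4, Matrix.add_mul, Matrix.smul_mul, Matrix.smul_mul, Matrix.one_mul, Matrix.mul_assoc]
  have h3 : (colMat u)ᴴ * huaMatrix u = (colMat u)ᴴ := by
    have := congrArg Matrix.conjTranspose (huaMatrix_mul_colMat hu)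
    rwa [Matrix.conjTranspose_mul, conjTranspose_huaMatrix] at this
  rw [h3, huaMatrix_eq, smul_add, smul_smul, smul_smul, ← add_assoc, ← add_smul]
  set s := Real.sqrt (1 - ‖u‖ ^ 2)
  have : 1 / (1 + s) + s * (1 / (1 + s)) = 1 := by field_simp
  rw [this, one_smul, h2]
  congr 2
  ring

theorem colMat_conjTranspose_mul_huaMatrix {u : HSpace n} (hu : u ∈ ball n) :
    (colMat u)ᴴ * huaMatrix u = (colMat u)ᴴ := by
  have := congrArg Matrix.conjTranspose (huaMatrix_mul_colMat hu)
  rwa [Matrix.conjTranspose_mul, conjTranspose_huaMatrix] at this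

/-- The matrix `(-A_u, u; -u*, 1) / s` inducing the Hua involution. -/
def huaBlock (u : HSpace n) : Matrix (Fin n ⊕ Unit) (Fin n ⊕ Unit) ℍ[ℝ] :=
  (Real.sqrt (1 - ‖u‖ ^ 2))⁻¹ • Matrix.fromBlocks (-huaMatrix u) (colMat u) (-(colMat u)ᴴ) 1

/-- Before scaling, the block matrix squares to `(1 - ‖u‖²) • 1`, since `A_u u = u` and `A_u² = u u*
+ (1 - ‖u‖²) I`. -/
theorem huaBlock_mul_self {u : HSpace n} (hu : u ∈ ball n) : huaBlock u * huaBlock u = 1 := by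
  have h1 := sqrt_one_sub_sq_pos hu
  rw [huaBlock, Matrix.smul_mul, Matrix.mul_smul, smul_smul, Matrix.fromBlocks_multiply]
  simp only [Matrix.neg_mul, Matrix.mul_neg, neg_neg, huaMatrix_mul_self hu,
    huaMatrix_mul_colMat hu, conjTranspose_mul_colMat, colMat_conjTranspose_mul_huaMatrix hu,
    Matrix.mul_one, Matrix.one_mul, add_neg_cancel, add_neg_cancel_comm, neg_add_cancel]
  have h2 : -(‖u‖ ^ 2 • (1 : Matrix Unit Unit ℍ[ℝ])) + 1 = (1 - ‖u‖ ^ 2) • 1 := by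
    rw [sub_smul, one_smul]; abel
  have h3 : (0 : Matrix (Fin n) Unit ℍ[ℝ]) = (1 - ‖u‖ ^ 2) • 0 := by simp
  have h4 : (0 : Matrix Unit (Fin n) ℍ[ℝ]) = (1 - ‖u‖ ^ 2) • 0 := by simp
  rw [h2, h3, h4, ← Matrix.fromBlocks_smul, smul_smul, Matrix.fromBlocks_one, ← mul_inv, ← sq,
    Real.sq_sqrt (one_sub_sq_pos hu).le, inv_mul_cancel₀ (one_sub_sq_pos hu).ne', one_smul]

/-- Combined with involutivity, this symmetry with respect to `J` gives membership in `Sp n`. -/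
theorem conjTranspose_huaBlock (u : HSpace n) :
    (huaBlock u)ᴴ * sigJ n = sigJ n * huaBlock u := by
  rw [huaBlock, conjTranspose_real_smul, Matrix.fromBlocks_conjTranspose, sigJ, Matrix.smul_mul,
    Matrix.mul_smul, Matrix.fromBlocks_multiply, Matrix.fromBlocks_multiply,
    Matrix.conjTranspose_neg, conjTranspose_huaMatrix]
  simp

/-- The Hua involution as an element of `Sp(n, 1)`. -/
def huaSp (u : HSpace n) (hu : u ∈ ball n) : Sp n :=
  ⟨⟨huaBlock u, huaBlock u, huaBlock_mul_self hu, huaBlock_mul_self hu⟩, by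
    change (huaBlock u)ᴴ * sigJ n * huaBlock u = sigJ n
    rw [conjTranspose_huaBlock, Matrix.mul_assoc, huaBlock_mul_self hu, Matrix.mul_one]⟩

theorem huaSp_mul_self {u : HSpace n} (hu : u ∈ ball n) : huaSp u hu * huaSp u hu = 1 := by
  ext1
  ext1
  exact huaBlock_mul_self hu

theorem act_huaSp {u : HSpace n} (hu : u ∈ ball n) (z : HSpace n) : act (huaSp u hu) z = Phi u z := by
  have h1 := sqrt_one_sub_sq_pos hu
  have h2 : huaBlock u *ᵥ lift z = fun i => (Sum.elim (fun i => u i - (huaMatrix u *ᵥ fun j => z j) i)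
      (fun _ => 1 - ∑ j, star (u j) * z j) i : ℍ[ℝ]) * (((Real.sqrt (1 - ‖u‖ ^ 2))⁻¹ : ℝ) : ℍ[ℝ]) := by
    rw [huaBlock, Matrix.smul_mulVec, lift, Matrix.fromBlocks_mulVec]
    ext1 i
    rw [Pi.smul_apply, ← Quaternion.coe_mul_eq_smul, (Quaternion.coe_commute _ _).eq]
    congr 1
    rcases i with i | i
    · simp [Matrix.neg_mulVec, colMat, Matrix.mulVec, dotProduct]
      abel
    · simp [Matrix.neg_mulVec, colMat, Matrix.mulVec, dotProduct]
      abel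
  have h3 : (((Real.sqrt (1 - ‖u‖ ^ 2))⁻¹ : ℝ) : ℍ[ℝ]) ≠ 0 := by
    rw [← Quaternion.coe_zero, Quaternion.coe_injective.ne_iff]
    exact inv_ne_zero h1.ne'
  rw [act]
  change proj (huaBlock u *ᵥ lift z) = _
  rw [h2, proj_mul_right _ h3]
  rfl

theorem Phi_mem_ball {u z : HSpace n} (hu : u ∈ ball n) (hz : z ∈ ball n) : Phi u z ∈ ball n := by
  rw [← act_huaSp hu]
  exact act_mem_ball _ hz

theorem Phi_Phi {u z : HSpace n} (hu : u ∈ ball n) (hz : z ∈ ball n) : Phi u (Phi u z) = z := by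
  rw [← act_huaSp hu, ← act_huaSp hu, ← act_mul _ _ hz, huaSp_mul_self, act_one]

theorem Phi_zero (u : HSpace n) : Phi u 0 = u := by
  ext1 i
  simp [Phi, Matrix.mulVec, dotProduct]

theorem Phi_self {u : HSpace n} (hu : u ∈ ball n) : Phi u u = 0 := by
  have := Phi_Phi hu zero_mem_ball
  rwa [Phi_zero] at this

/-! ### Determinants and the derivative of a Hua involution at the origin -/

theorem abs_det_eq_one_of_norm_map {E : Type*} [NormedAddCommGroup E] [InnerProductSpace ℝ E]
    [FiniteDimensional ℝ E] (L : E →L[ℝ] E) (h : ∀ v, ‖L v‖ = ‖v‖) : |L.det| = 1 := by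
  have := LinearIsometry.normDet_eq_one (⟨L.toLinearMap, h⟩ : E →ₗᵢ[ℝ] E)
  rwa [LinearMap.normDet_eq_abs_det] at this

/-- `L v` is the limit of `k • f (v / k)`, whose norm is exactly `‖v‖` for large `k`. -/
theorem norm_fderiv_eq_of_norm_eq {E : Type*} [NormedAddCommGroup E] [NormedSpace ℝ E] {f : E → E}
    {L : E →L[ℝ] E} (hL : HasFDerivAt f L 0) (h : ∀ᶠ z in nhds (0 : E), ‖f z‖ = ‖z‖) (v : E) :
    ‖L v‖ = ‖v‖ := by
  have h0 : f 0 = 0 := by simpa using h.self_of_nhds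
  have hc : Filter.Tendsto (fun k : ℕ => ‖(k : ℝ)‖) Filter.atTop Filter.atTop := by
    simpa using tendsto_natCast_atTop_atTop
  have h1 := (hL.lim v hc).norm
  have h2 : Filter.Tendsto (fun k : ℕ => (k : ℝ)⁻¹ • v) Filter.atTop (nhds 0) := by
    simpa using (tendsto_inv_atTop_nhds_zero_nat (𝕜 := ℝ)).smul_const v
  refine tendsto_nhds_unique h1 (tendsto_const_nhds.congr' ?_)
  filter_upwards [h2.eventually h, Filter.eventually_gt_atTop 0] with k hk hk0
  have hk0' : (k : ℝ) ≠ 0 := by positivity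
  rw [zero_add, h0, sub_zero, norm_smul, hk, ← norm_smul, smul_inv_smul₀ hk0']

theorem det_id_add_comp_comm {V W : Type*} [AddCommGroup V] [Module ℝ V] [FiniteDimensional ℝ V]
    [AddCommGroup W] [Module ℝ W] [FiniteDimensional ℝ W] (f : V →ₗ[ℝ] W) (g : W →ₗ[ℝ] V) :
    LinearMap.det (LinearMap.id + f ∘ₗ g) = LinearMap.det (LinearMap.id + g ∘ₗ f) := by
  classical
  let b := Module.finBasis ℝ V
  let c := Module.finBasis ℝ W
  rw [← LinearMap.det_toMatrix b, ← LinearMap.det_toMatrix c, map_add, map_add,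
    LinearMap.toMatrix_comp c b c, LinearMap.toMatrix_comp b c b, LinearMap.toMatrix_id,
    LinearMap.toMatrix_id, Matrix.det_one_add_mul_comm]

/-- The real-linear map `z ↦ ∑ j, conj (u j) * z j`. -/
def ipL (u : HSpace n) : HSpace n →L[ℝ] ℍ[ℝ] :=
  ∑ j, (ContinuousLinearMap.mul ℝ ℍ[ℝ] (star (u j))) ∘L (PiLp.proj 2 (fun _ : Fin n => ℍ[ℝ]) j)

theorem ipL_apply (u z : HSpace n) : ipL u z = ip z u := by
  simp [ipL, ip]

/-- The real-linear map `h ↦ u h`. -/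
def colL (u : HSpace n) : ℍ[ℝ] →ₗ[ℝ] HSpace n where
  toFun h := WithLp.toLp 2 fun i => u i * h
  map_add' a b := by ext1 i; simp [mul_add]
  map_smul' r a := by ext1 i; simp

theorem continuous_ip_left (w : HSpace n) : Continuous fun z => ip z w := by
  simp only [← ipL_apply]
  exact (ipL w).continuous

/-- The derivative at the origin of the Hua involution `Φ_u`. -/
def huaDeriv (u : HSpace n) : HSpace n →L[ℝ] HSpace n :=
  (-Real.sqrt (1 - ‖u‖ ^ 2)) • (ContinuousLinearMap.id ℝ _ +
    (LinearMap.toContinuousLinearMap ((-(1 / (1 + Real.sqrt (1 - ‖u‖ ^ 2)))) • colL u)) ∘L ipL u)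

theorem huaMatrix_mulVec (u z : HSpace n) (i : Fin n) : (huaMatrix u *ᵥ fun j => z j) i =
    (1 / (1 + Real.sqrt (1 - ‖u‖ ^ 2))) • (u i * ip z u) + Real.sqrt (1 - ‖u‖ ^ 2) • z i := by
  rw [huaMatrix, Matrix.add_mulVec, Matrix.smul_mulVec, Matrix.smul_mulVec, Matrix.one_mulVec]
  simp [Matrix.mulVec, dotProduct, Matrix.vecMulVec, ip, Finset.mul_sum, mul_assoc]

/-- The derivative is `-s` times a perturbation of the identity factoring through `ℍ`. Exchanging
the factors moves the determinant to `ℍ`, where the map is multiplication by `s`; the total is `s ^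
(4n) * s ^ 4` with `s² = 1 - ‖u‖²`. -/
theorem abs_det_huaDeriv {u : HSpace n} (hu : u ∈ ball n) :
    |(huaDeriv u).det| = (1 - ‖u‖ ^ 2) ^ (2 * n + 2) := by
  have h1 := sqrt_one_sub_sq_pos hu
  have h2 := norm_sq_eq_sqrt hu
  have h3 : Real.sqrt (1 - ‖u‖ ^ 2) ^ 2 = 1 - ‖u‖ ^ 2 := Real.sq_sqrt (one_sub_sq_pos hu).le
  have hd : (huaDeriv u).det = LinearMap.det ((-Real.sqrt (1 - ‖u‖ ^ 2)) • (LinearMap.id +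
      ((-(1 / (1 + Real.sqrt (1 - ‖u‖ ^ 2)))) • colL u) ∘ₗ (ipL u).toLinearMap)) := rfl
  have hf : Module.finrank ℝ (HSpace n) = 4 * n := by
    rw [(WithLp.linearEquiv 2 ℝ (Fin n → ℍ[ℝ])).finrank_eq, Module.finrank_pi_fintype]
    simp [Quaternion.finrank_eq_four, mul_comm]
  have hc : LinearMap.id + (ipL u).toLinearMap ∘ₗ ((-(1 / (1 + Real.sqrt (1 - ‖u‖ ^ 2)))) • colL u)
      = Real.sqrt (1 - ‖u‖ ^ 2) • LinearMap.id := by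
    refine LinearMap.ext fun q => ?_
    have hq : ip (colL u q) u = (‖u‖ ^ 2) • q := by
      have : ip (colL u q) u = ip u u * q := by
        simp [ip, colL, Finset.sum_mul, mul_assoc]
      rw [this, ip_self, Quaternion.coe_mul_eq_smul]
    simp only [LinearMap.add_apply, LinearMap.id_apply, LinearMap.comp_apply, LinearMap.smul_apply,
      map_smul, ContinuousLinearMap.coe_coe, ipL_apply, hq]
    rw [smul_smul]
    nth_rewrite 1 [← one_smul ℝ q]
    rw [← add_smul]
    congr 1
    generalize Real.sqrt (1 - ‖u‖ ^ 2) = s at h1 h2 ⊢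
    rw [h2]
    field_simp
    ring
  rw [hd, LinearMap.det_smul, det_id_add_comp_comm, hc, LinearMap.det_smul, LinearMap.det_id, hf,
    Quaternion.finrank_eq_four, mul_one, abs_mul, abs_pow, abs_pow, abs_neg, abs_of_pos h1,
    ← pow_add]
  generalize Real.sqrt (1 - ‖u‖ ^ 2) = s at h3 ⊢
  rw [← h3, ← pow_mul]
  congr 1
  ring

theorem hasFDerivAt_Phi (u : HSpace n) : HasFDerivAt (Phi u) (huaDeriv u) 0 := by
  rw [← hasFDerivWithinAt_univ, hasFDerivWithinAt_piLp 2]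
  intro i
  rw [hasFDerivWithinAt_univ]
  have h1 : HasFDerivAt (fun z : HSpace n => 1 - ip z u) (-ipL u) 0 := by
    simp only [← ipL_apply]
    exact (ipL u).hasFDerivAt.const_sub 1
  have h2 := (hasFDerivAt_inv' (𝕜 := ℝ) (one_ne_zero (α := ℍ[ℝ])))
  have h3 : HasFDerivAt (fun z : HSpace n => (1 - ip z u)⁻¹) _ 0 :=
    HasFDerivAt.comp (0 : HSpace n) (g := Inv.inv) (by simpa using h2) h1
  have h4 : HasFDerivAt (fun z : HSpace n => u i - ((1 / (1 + Real.sqrt (1 - ‖u‖ ^ 2))) •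
      (u i * ipL u z) + Real.sqrt (1 - ‖u‖ ^ 2) • z i)) _ 0 :=
    (((((ContinuousLinearMap.mul ℝ ℍ[ℝ] (u i)) ∘L ipL u).hasFDerivAt (x := 0)).const_smul
      (1 / (1 + Real.sqrt (1 - ‖u‖ ^ 2)))).add
      (((PiLp.proj 2 (fun _ : Fin n => ℍ[ℝ]) i : HSpace n →L[ℝ] ℍ[ℝ]).hasFDerivAt
        (x := 0)).const_smul (Real.sqrt (1 - ‖u‖ ^ 2)))).const_sub (u i)
  have h5 := h4.mul' h3
  have h6 : (fun z => (Phi u z) i) = fun z : HSpace n => (u i - ((1 / (1 + Real.sqrt (1 - ‖u‖ ^ 2))) •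
      (u i * ipL u z) + Real.sqrt (1 - ‖u‖ ^ 2) • z i)) * (1 - ip z u)⁻¹ := by
    ext1 z
    simp only [Phi, huaMatrix_mulVec, ipL_apply, ip]
  rw [h6]
  refine HasFDerivAt.congr_fderiv h5 (ContinuousLinearMap.ext fun v => ?_)
  simp [huaDeriv, ipL_apply, colL]
  have hs : 0 < 1 + Real.sqrt (1 - ‖u‖ ^ 2) := by positivity
  -- The identity `s / (1 + s) = 1 - 1 / (1 + s)` merges the two multiples of `u ⟨v, u⟩`, one from
  -- `A_u` and one from differentiating the inverse.
  have e : ∀ q : ℍ[ℝ], Real.sqrt (1 - ‖u‖ ^ 2) • (1 + Real.sqrt (1 - ‖u‖ ^ 2))⁻¹ • q =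
      q - (1 + Real.sqrt (1 - ‖u‖ ^ 2))⁻¹ • q := by
    intro q
    rw [eq_sub_iff_add_eq, smul_smul, ← add_smul]
    nth_rewrite 2 [← one_smul ℝ q]
    congr 1
    field_simp
    ring
  rw [e]
  abel

/-! ### Invariance of the hyperbolic measure -/

theorem lam_density_measurable : Measurable fun q : HSpace n =>
    ENNReal.ofReal (4 ^ (2 * n) / (1 - ‖q‖ ^ 2) ^ (2 * n + 2)) := by
  fun_prop

theorem measurableSet_ball : MeasurableSet (ball n) := by
  rw [ball_eq]
  exact Metric.isOpen_ball.measurableSet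

theorem ae_mem_ball : ∀ᵐ y ∂(Lam n), y ∈ ball n :=
  (withDensity_absolutelyContinuous _ _).ae_le (ae_restrict_mem measurableSet_ball)

theorem Lam_absolutelyContinuous : Lam n ≪ volume :=
  (withDensity_absolutelyContinuous _ _).trans Measure.absolutelyContinuous_restrict

theorem restrict_volume_absolutelyContinuous_Lam : volume.restrict (ball n) ≪ Lam n := by
  refine withDensity_absolutelyContinuous' lam_density_measurable.aemeasurable ?_
  filter_upwards [ae_restrict_mem measurableSet_ball] with q hq
  have := one_sub_sq_pos hq
  rw [Ne, ENNReal.ofReal_eq_zero, not_le]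
  positivity

/-- The density is positive on the ball, so both measures have the same null sets there.
Admissibility is phrased with Lebesgue measure, the transport arguments with `Lam n`. -/
theorem nullMeasurableSet_volume_iff {E : Set (HSpace n)} (hE : E ⊆ ball n) :
    NullMeasurableSet E volume ↔ NullMeasurableSet E (Lam n) := by
  refine ⟨fun h => h.mono_ac Lam_absolutelyContinuous, fun h => ?_⟩
  have := h.mono_ac restrict_volume_absolutelyContinuous_Lam
  rwa [nullMeasurableSet_restrict measurableSet_ball.nullMeasurableSet,
    Set.inter_eq_left.2 hE] at this

theorem measurable_act (g : Sp n) : Measurable (act g) := by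
  unfold act proj
  refine (WithLp.measurable_toLp 2 _).comp (measurable_pi_lambda _ fun i => ?_)
  have h : ∀ k, Measurable fun z : HSpace n => (g.val.val *ᵥ lift z) k := by
    intro k
    simp only [Matrix.mulVec, dotProduct]
    refine Finset.measurable_sum _ fun j _ => Measurable.const_mul ?_ _
    rcases j with j | j
    · exact (PiLp.continuous_apply 2 _ j).measurable
    · exact measurable_const
  exact (h _).mul (h _).inv

theorem differentiableAt_act (g : Sp n) {z : HSpace n} (hz : z ∈ ball n) :
    DifferentiableAt ℝ (act g) z := by
  rw [differentiableAt_piLp 2]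
  intro i
  have h : ∀ k, DifferentiableAt ℝ (fun z : HSpace n => (g.val.val *ᵥ lift z) k) z := by
    intro k
    simp only [Matrix.mulVec, dotProduct]
    refine DifferentiableAt.fun_sum fun j _ => DifferentiableAt.const_mul ?_ _
    rcases j with j | j
    · exact (PiLp.proj 2 (fun _ : Fin n => ℍ[ℝ]) j : HSpace n →L[ℝ] ℍ[ℝ]).differentiableAt
    · exact differentiableAt_const _
  exact (h _).mul ((h _).inv (last_mulVec_lift_ne_zero g hz))

theorem norm_act_of_act_zero {g : Sp n} (hg : act g 0 = 0) {z : HSpace n} (hz : z ∈ ball n) :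
    ‖act g z‖ = ‖z‖ := by
  have h := coshSq_act g zero_mem_ball hz
  have h1 := one_sub_sq_pos hz
  have h2 := one_sub_sq_pos (act_mem_ball g hz)
  rw [hg, coshSq, coshSq] at h
  simp only [ip_zero_left, sub_zero, norm_one, norm_zero] at h
  field_simp at h
  have h3 : ‖act g z‖ ^ 2 = ‖z‖ ^ 2 := by linarith
  exact (pow_left_inj₀ (norm_nonneg _) (norm_nonneg _) two_ne_zero).1 h3

theorem ball_mem_nhds {z : HSpace n} (hz : z ∈ ball n) : ball n ∈ nhds z := by
  rw [ball_eq] at hz ⊢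
  exact Metric.isOpen_ball.mem_nhds hz

/-- Conjugating by Hua involutions turns `g` into an element `h` fixing the origin. Such an `h`
preserves norms, so its derivative at the origin has determinant of absolute value 1, and only the
two Hua Jacobians remain. -/
theorem abs_det_fderiv_act (g : Sp n) {z : HSpace n} (hz : z ∈ ball n) :
    |(fderiv ℝ (act g) z).det| = ((1 - ‖act g z‖ ^ 2) / (1 - ‖z‖ ^ 2)) ^ (2 * n + 2) := by
  have hw := act_mem_ball g hz
  have h1 := one_sub_sq_pos hz
  set h := huaSp (act g z) hw * g * huaSp z hz with hh
  have hact : ∀ x ∈ ball n, act h x = Phi (act g z) (act g (Phi z x)) := by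
    intro x hx
    rw [hh, act_mul _ _ hx, act_huaSp, act_mul _ _ (Phi_mem_ball hz hx), act_huaSp]
  have h0 : act h 0 = 0 := by rw [hact 0 zero_mem_ball, Phi_zero, Phi_self hw]
  have hD : |(fderiv ℝ (act h) 0).det| = 1 := by
    refine abs_det_eq_one_of_norm_map _ (norm_fderiv_eq_of_norm_eq
      (differentiableAt_act h zero_mem_ball).hasFDerivAt ?_)
    filter_upwards [ball_mem_nhds zero_mem_ball] with x hx using norm_act_of_act_zero h0 hx
  -- The same map near the origin is differentiated in two ways: as `g ∘ Φ_z`, and as `Φ_{g z} ∘ h`.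
  -- This avoids differentiating a Hua involution away from the origin.
  have e1 : HasFDerivAt (fun x => act g (Phi z x)) ((fderiv ℝ (act g) z) ∘L huaDeriv z) 0 := by
    refine HasFDerivAt.comp (g := act g) (f := Phi z) (0 : HSpace n) ?_ (hasFDerivAt_Phi z)
    rw [Phi_zero]
    exact (differentiableAt_act g hz).hasFDerivAt
  have e2 : HasFDerivAt (fun x => act g (Phi z x))
      (huaDeriv (act g z) ∘L fderiv ℝ (act h) 0) 0 := by
    have e3 : HasFDerivAt (fun x => Phi (act g z) (act h x))
        (huaDeriv (act g z) ∘L fderiv ℝ (act h) 0) 0 := by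
      refine HasFDerivAt.comp (g := Phi (act g z)) (f := act h) (0 : HSpace n) ?_
        (differentiableAt_act h zero_mem_ball).hasFDerivAt
      rw [h0]
      exact hasFDerivAt_Phi _
    refine e3.congr_of_eventuallyEq ?_
    filter_upwards [ball_mem_nhds zero_mem_ball] with x hx
    rw [hact x hx, Phi_Phi hw (act_mem_ball g (Phi_mem_ball hz hx))]
  have hdet : |((fderiv ℝ (act g) z) ∘L huaDeriv z).det| =
      |(huaDeriv (act g z) ∘L fderiv ℝ (act h) 0).det| := by rw [e1.unique e2]
  have hmul : ∀ S T : HSpace n →L[ℝ] HSpace n, |(S ∘L T).det| = |S.det| * |T.det| := by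
    intro S T
    rw [← abs_mul]
    exact congrArg abs (LinearMap.det_comp S.toLinearMap T.toLinearMap)
  rw [hmul, hmul, abs_det_huaDeriv hz, abs_det_huaDeriv hw, hD, mul_one] at hdet
  rw [div_pow, eq_div_iff (by positivity), hdet]

theorem act_injOn (g : Sp n) : Set.InjOn (act g) (ball n) := by
  intro x hx y hy h
  rw [← act_inv_act g hx, h, act_inv_act g hy]

theorem act_image_preimage (g : Sp n) (S : Set (HSpace n)) :
    act g '' (act g ⁻¹' S ∩ ball n) = S ∩ ball n := by
  ext y
  constructor
  · rintro ⟨x, ⟨hx, hxb⟩, rfl⟩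
    exact ⟨hx, act_mem_ball g hxb⟩
  · rintro ⟨hy, hyb⟩
    refine ⟨act g⁻¹ y, ⟨?_, act_mem_ball _ hyb⟩, act_act_inv g hyb⟩
    rwa [Set.mem_preimage, act_act_inv g hyb]

theorem Lam_apply {S : Set (HSpace n)} (hS : MeasurableSet S) : Lam n S =
    ∫⁻ q in S ∩ ball n, ENNReal.ofReal (4 ^ (2 * n) / (1 - ‖q‖ ^ 2) ^ (2 * n + 2)) := by
  rw [Lam, withDensity_apply _ hS, Measure.restrict_restrict hS]

theorem measurePreserving_act (g : Sp n) : MeasurePreserving (act g) (Lam n) (Lam n) := by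
  refine ⟨measurable_act g, Measure.ext fun S hS => ?_⟩
  have hS' := measurable_act g hS
  rw [Measure.map_apply (measurable_act g) hS, Lam_apply hS', Lam_apply hS, ← act_image_preimage g S,
    lintegral_image_eq_lintegral_abs_det_fderiv_mul volume (hS'.inter measurableSet_ball)
      (fun x hx => (differentiableAt_act g hx.2).hasFDerivAt.hasFDerivWithinAt)
      ((act_injOn g).mono Set.inter_subset_right)]
  refine setLIntegral_congr_fun (hS'.inter measurableSet_ball) fun x hx => ?_
  have h1 := one_sub_sq_pos hx.2
  have h2 := one_sub_sq_pos (act_mem_ball g hx.2)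
  rw [← ENNReal.ofReal_mul (abs_nonneg _), abs_det_fderiv_act g hx.2, div_pow]
  congr 1
  field_simp

theorem image_act_eq (g : Sp n) {D : Set (HSpace n)} (hD : D ⊆ ball n) :
    act g '' D = act g⁻¹ ⁻¹' D ∩ ball n := by
  ext y
  constructor
  · rintro ⟨x, hx, rfl⟩
    exact ⟨by rwa [Set.mem_preimage, act_inv_act g (hD hx)], act_mem_ball g (hD hx)⟩
  · rintro ⟨hy, hyb⟩
    exact ⟨act g⁻¹ y, hy, act_act_inv g hyb⟩

theorem nullMeasurableSet_image_act (g : Sp n) {D : Set (HSpace n)} (hD : D ⊆ ball n)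
    (hm : NullMeasurableSet D (Lam n)) : NullMeasurableSet (act g '' D) (Lam n) := by
  rw [image_act_eq g hD]
  exact (hm.preimage (measurePreserving_act g⁻¹).quasiMeasurePreserving).inter
    measurableSet_ball.nullMeasurableSet

theorem measurePreserving_act_restrict (g : Sp n) {D : Set (HSpace n)} (hD : D ⊆ ball n)
    (hm : NullMeasurableSet D (Lam n)) :
    MeasurePreserving (act g) ((Lam n).restrict D) ((Lam n).restrict (act g '' D)) := by
  have hE := nullMeasurableSet_image_act g hD hm
  obtain ⟨E, hEm, hEe⟩ := hE
  -- Restricting a measure-preserving map to a preimage uses a measurable set, so `E` replaces the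
  -- image up to a null set; injectivity on the ball identifies the preimage with `D`.
  have h1 : act g ⁻¹' E =ᵐ[Lam n] D := by
    refine ((measurePreserving_act g).quasiMeasurePreserving.preimage_ae_eq hEe.symm).trans ?_
    filter_upwards [ae_mem_ball] with x hx
    refine propext ⟨?_, fun h => ⟨x, h, rfl⟩⟩
    rintro ⟨y, hy, hyx⟩
    rwa [← act_injOn g (hD hy) hx hyx]
  rw [Measure.restrict_congr_set hEe, ← Measure.restrict_congr_set h1]
  exact (measurePreserving_act g).restrict_preimage hEm

/-! ### Strict convexity of the energy density along geodesics -/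

/-- Strict Jensen inequality for `exp` at the points `t, -t, 0` with weights `A, B, C` and mean `m
t`, where `m = A - B`. Factoring out `exp (m t)` reduces it to `x + 1 ≤ exp x`; strictness comes
from the first term, as `1 - m = 2B + C > 0`. -/
theorem lt_log_exp_sum {A B C t : ℝ} (hA : 0 < A) (hB : 0 < B) (hC : 0 < C) (h : A + B + C = 1)
    (ht : t ≠ 0) : (A - B) * t < Real.log (A * Real.exp t + B * Real.exp (-t) + C) := by
  have hF : 0 < A * Real.exp t + B * Real.exp (-t) + C := by positivity
  rw [Real.lt_log_iff_exp_lt hF]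
  set m := A - B with hm
  have h1 : (1 - m) * t + 1 < Real.exp ((1 - m) * t) := by
    refine Real.add_one_lt_exp (mul_ne_zero ?_ ht)
    linarith
  have h2 := Real.add_one_le_exp (-(1 + m) * t)
  have h3 := Real.add_one_le_exp (-m * t)
  have e1 : Real.exp t = Real.exp (m * t) * Real.exp ((1 - m) * t) := by
    rw [← Real.exp_add]; congr 1; ring
  have e2 : Real.exp (-t) = Real.exp (m * t) * Real.exp (-(1 + m) * t) := by
    rw [← Real.exp_add]; congr 1; ring
  have e3 : 1 = Real.exp (m * t) * Real.exp (-m * t) := by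
    rw [← Real.exp_add, ← Real.exp_zero]; congr 1; ring
  have h4 : 1 < A * Real.exp ((1 - m) * t) + B * Real.exp (-(1 + m) * t)
      + C * Real.exp (-m * t) := by
    have := mul_lt_mul_of_pos_left h1 hA
    have := mul_le_mul_of_nonneg_left h2 hB.le
    have := mul_le_mul_of_nonneg_left h3 hC.le
    have h5 : A * ((1 - m) * t + 1) + B * (-(1 + m) * t + 1) + C * (-m * t + 1) = 1 := by
      have hC' : C = 1 - A - B := by linarith
      rw [hC', hm]; ring
    linarith
  calc Real.exp (m * t) < Real.exp (m * t) * (A * Real.exp ((1 - m) * t)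
        + B * Real.exp (-(1 + m) * t) + C * Real.exp (-m * t)) :=
        lt_mul_of_one_lt_right (Real.exp_pos _) h4
    _ = A * Real.exp t + B * Real.exp (-t) + C * (Real.exp (m * t) * Real.exp (-m * t)) := by
        rw [e1, e2]; ring
    _ = _ := by rw [← e3, mul_one]

/-- Tangent line at an arbitrary `s`: dividing the three terms by their sum at `s` gives weights of
sum 1, which reduces to the tangent at `0`. -/
theorem log_exp_sum_add_lt {A B C s t : ℝ} (hA : 0 < A) (hB : 0 < B) (hC : 0 < C) (ht : t ≠ s) :
    Real.log (A * Real.exp s + B * Real.exp (-s) + C) +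
      (A * Real.exp s - B * Real.exp (-s)) / (A * Real.exp s + B * Real.exp (-s) + C) * (t - s) <
    Real.log (A * Real.exp t + B * Real.exp (-t) + C) := by
  set F := A * Real.exp s + B * Real.exp (-s) + C with hF
  have hF0 : 0 < F := by positivity
  have h := lt_log_exp_sum (A := A * Real.exp s / F) (B := B * Real.exp (-s) / F) (C := C / F)
    (t := t - s) (by positivity) (by positivity) (by positivity)
    (by rw [← add_div, ← add_div, ← hF, div_self hF0.ne']) (sub_ne_zero.2 ht)
  have h2 : A * Real.exp s / F * Real.exp (t - s) + B * Real.exp (-s) / F * Real.exp (-(t - s))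
      + C / F = (A * Real.exp t + B * Real.exp (-t) + C) / F := by
    have e1 : Real.exp t = Real.exp s * Real.exp (t - s) := by
      rw [← Real.exp_add]; congr 1; ring
    have e2 : Real.exp (-t) = Real.exp (-s) * Real.exp (-(t - s)) := by
      rw [← Real.exp_add]; congr 1; ring
    rw [e1, e2]; ring
  rw [h2, Real.log_div (by positivity) hF0.ne', ← sub_div] at h
  linarith

theorem strictConvexOn_log_exp_sum {A B C : ℝ} (hA : 0 < A) (hB : 0 < B) (hC : 0 < C) :
    StrictConvexOn ℝ Set.univ
      fun t => Real.log (A * Real.exp t + B * Real.exp (-t) + C) := by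
  refine ⟨convex_univ, fun x _ y _ hxy a b ha hb hab => ?_⟩
  simp only [smul_eq_mul]
  have hx : x ≠ a * x + b * y := by
    intro h
    have hb' : b * (x - y) = 0 := by
      have : a = 1 - b := by linarith
      rw [this] at h
      linarith
    exact hxy (sub_eq_zero.1 ((mul_eq_zero.1 hb').resolve_left hb.ne'))
  have hy : y ≠ a * x + b * y := by
    intro h
    have ha' : a * (x - y) = 0 := by
      have : b = 1 - a := by linarith
      rw [this] at h
      linarith
    exact hxy (sub_eq_zero.1 ((mul_eq_zero.1 ha').resolve_left ha.ne'))
  have h1 := mul_lt_mul_of_pos_left (log_exp_sum_add_lt hA hB hC hx) ha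
  have h2 := mul_lt_mul_of_pos_left (log_exp_sum_add_lt hA hB hC hy) hb
  set w := a * x + b * y with hw
  set L := Real.log (A * Real.exp w + B * Real.exp (-w) + C)
  set m := (A * Real.exp w - B * Real.exp (-w)) / (A * Real.exp w + B * Real.exp (-w) + C)
  have h3 : a * (L + m * (x - w)) + b * (L + m * (y - w)) = L := by
    have hb' : b = 1 - a := by linarith
    rw [hw, hb']; ring
  linarith

theorem norm_one_sub_smul_sq (r : ℝ) (q : ℍ[ℝ]) :
    ‖1 - r • q‖ ^ 2 = 1 - 2 * r * q.re + r ^ 2 * ‖q‖ ^ 2 := by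
  rw [norm_sub_sq_real, real_inner_smul_right, Quaternion.inner_def, norm_smul, mul_pow,
    Real.norm_eq_abs, sq_abs, norm_one]
  simp
  ring

/-- The unit-speed geodesic ray from the origin in the direction of the unit vector `e`. -/
def ray (e : HSpace n) (t : ℝ) : HSpace n := Real.tanh (t / 2) • e

theorem ray_zero (e : HSpace n) : ray e 0 = 0 := by simp [ray]

theorem one_sub_tanh_sq (t : ℝ) : 1 - Real.tanh t ^ 2 = 1 / Real.cosh t ^ 2 := by
  have := Real.cosh_pos t
  have h := Real.cosh_sq t
  rw [Real.tanh_eq_sinh_div_cosh]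
  field_simp
  linarith

theorem one_sub_norm_ray_sq {e : HSpace n} (he : ‖e‖ = 1) (t : ℝ) :
    1 - ‖ray e t‖ ^ 2 = 1 / Real.cosh (t / 2) ^ 2 := by
  rw [ray, norm_smul, he, mul_one, Real.norm_eq_abs, sq_abs, one_sub_tanh_sq]

theorem mem_ball_of_one_sub_sq_pos {z : HSpace n} (h : 0 < 1 - ‖z‖ ^ 2) : z ∈ ball n := by
  rw [mem_ball_iff, ← sq_lt_one_iff₀ (norm_nonneg z)]
  linarith

theorem ray_mem_ball {e : HSpace n} (he : ‖e‖ = 1) (t : ℝ) : ray e t ∈ ball n := by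
  refine mem_ball_of_one_sub_sq_pos ?_
  rw [one_sub_norm_ray_sq he]
  have := Real.cosh_pos (t / 2)
  positivity

theorem norm_ip_lt_one {e y : HSpace n} (he : ‖e‖ = 1) (hy : y ∈ ball n) : ‖ip e y‖ < 1 := by
  have := norm_ip_le e y
  rw [he, one_mul] at this
  exact this.trans_lt (mem_ball_iff.1 hy)

theorem coshSq_ray {e y : HSpace n} (he : ‖e‖ = 1) (t : ℝ) :
    coshSq (ray e t) y = (‖1 - ip e y‖ ^ 2 / 4 * Real.exp t + ‖1 + ip e y‖ ^ 2 / 4 * Real.exp (-t) +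
      (1 - ‖ip e y‖ ^ 2) / 2) / (1 - ‖y‖ ^ 2) := by
  have h1 := norm_one_sub_smul_sq 1 (ip e y)
  have h2 := norm_one_sub_smul_sq (-1) (ip e y)
  rw [one_smul] at h1
  rw [neg_smul, one_smul, sub_neg_eq_add] at h2
  rw [coshSq, one_sub_norm_ray_sq he, ray, ip_smul_left, norm_one_sub_smul_sq, h1, h2,
    ← div_div]
  congr 1
  generalize (ip e y).re = a
  generalize ‖ip e y‖ = b
  have e1 : Real.exp t = Real.exp (t / 2) ^ 2 := by
    rw [← Real.exp_nat_mul]; congr 1; push_cast; ring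
  have e2 : Real.exp (-t) = (Real.exp (t / 2) ^ 2)⁻¹ := by rw [Real.exp_neg, e1]
  have h3 := Real.cosh_pos (t / 2)
  rw [e1, e2, Real.tanh_eq_sinh_div_cosh]
  have h4 : (1 - 2 * (Real.sinh (t / 2) / Real.cosh (t / 2)) * a +
      (Real.sinh (t / 2) / Real.cosh (t / 2)) ^ 2 * b ^ 2) / (1 / Real.cosh (t / 2) ^ 2) =
      Real.cosh (t / 2) ^ 2 - 2 * Real.sinh (t / 2) * Real.cosh (t / 2) * a +
        Real.sinh (t / 2) ^ 2 * b ^ 2 := by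
    field_simp
  rw [h4, Real.cosh_eq, Real.sinh_eq, Real.exp_neg]
  have h5 := Real.exp_pos (t / 2)
  field_simp
  ring

theorem exists_energyDensity_ray_eq {e y : HSpace n} (he : ‖e‖ = 1) (hy : y ∈ ball n) :
    ∃ A B C : ℝ, 0 < A ∧ 0 < B ∧ 0 < C ∧ A + B + C = 1 ∧ A - B = -inner ℝ e y ∧
      ∀ t, energyDensity (ray e t) y =
        Real.log (A * Real.exp t + B * Real.exp (-t) + C) - Real.log (1 - ‖y‖ ^ 2) := by
  have hη := norm_ip_lt_one he hy
  have h1 := norm_one_sub_smul_sq 1 (ip e y)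
  have h2 := norm_one_sub_smul_sq (-1) (ip e y)
  rw [one_smul] at h1
  rw [neg_smul, one_smul, sub_neg_eq_add] at h2
  have hA : 0 < ‖1 - ip e y‖ := by
    have := norm_sub_norm_le (1 : ℍ[ℝ]) (ip e y)
    rw [norm_one] at this
    linarith
  have hB : 0 < ‖1 + ip e y‖ := by
    have := norm_sub_norm_le (1 : ℍ[ℝ]) (-ip e y)
    rw [norm_one, norm_neg, sub_neg_eq_add] at this
    linarith
  have hC : 0 < (1 - ‖ip e y‖ ^ 2) / 2 := by nlinarith [norm_nonneg (ip e y)]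
  have hy' := one_sub_sq_pos hy
  refine ⟨‖1 - ip e y‖ ^ 2 / 4, ‖1 + ip e y‖ ^ 2 / 4, (1 - ‖ip e y‖ ^ 2) / 2, by positivity,
    by positivity, hC, ?_, ?_, fun t => ?_⟩
  · rw [h1, h2]; ring
  · rw [h1, h2, ip_re]; ring
  · rw [energyDensity_eq_log (ray_mem_ball he t) hy, coshSq_ray he, Real.log_div (by positivity)
      hy'.ne']

theorem strictConvexOn_energyDensity_ray {e y : HSpace n} (he : ‖e‖ = 1) (hy : y ∈ ball n) :
    StrictConvexOn ℝ Set.univ fun t => energyDensity (ray e t) y := by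
  obtain ⟨A, B, C, hA, hB, hC, -, -, h⟩ := exists_energyDensity_ray_eq he hy
  simp only [h, sub_eq_add_neg]
  exact (strictConvexOn_log_exp_sum hA hB hC).add_const _

theorem energyDensity_ray_gt {e y : HSpace n} (he : ‖e‖ = 1) (hy : y ∈ ball n) {t : ℝ}
    (ht : t ≠ 0) : energyDensity 0 y - t * inner ℝ e y < energyDensity (ray e t) y := by
  obtain ⟨A, B, C, hA, hB, hC, h1, h2, h⟩ := exists_energyDensity_ray_eq he hy
  have h0 := h 0
  rw [ray_zero, neg_zero, Real.exp_zero, mul_one, mul_one, h1, Real.log_one] at h0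
  have h3 := lt_log_exp_sum hA hB hC h1 ht
  rw [h0, h, ← neg_neg (inner ℝ e y), ← h2]
  linarith

theorem norm_eq_tanh {z : HSpace n} (hz : z ∈ ball n) : ‖z‖ = Real.tanh (dH 0 z / 2) := by
  have h0 := dH_nonneg zero_mem_ball hz
  have h1 := cosh_sq_dH zero_mem_ball hz
  have h2 := one_sub_tanh_sq (dH 0 z / 2)
  have h3 := one_sub_sq_pos hz
  rw [h1, coshSq] at h2
  simp only [ip_zero_left, sub_zero, norm_one, norm_zero] at h2
  have h4 : ‖z‖ ^ 2 = Real.tanh (dH 0 z / 2) ^ 2 := by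
    field_simp at h2
    linarith
  have h5 : 0 ≤ Real.tanh (dH 0 z / 2) := by
    rw [Real.tanh_eq_sinh_div_cosh]
    exact div_nonneg (Real.sinh_nonneg_iff.2 (by linarith)) (Real.cosh_pos _).le
  exact (pow_left_inj₀ (norm_nonneg _) h5 two_ne_zero).1 h4

/-- Equality in the triangle inequality forces `‖1 - ⟨z, y⟩‖ = 1 - ‖z‖ ‖y‖`. Hence equality holds in
the real Cauchy–Schwarz inequality, and `z` is a nonnegative multiple of `y`. -/
theorem eq_ray_of_dH_add {y z : HSpace n} (hy : y ∈ ball n) (hz : z ∈ ball n) (hy0 : 0 < dH 0 y)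
    (h : dH z y = dH 0 y - dH 0 z) : z = ray (‖y‖⁻¹ • y) (dH 0 z) := by
  have hny := norm_eq_tanh hy
  have hnz := norm_eq_tanh hz
  have h1 := cosh_sq_dH hz hy
  have hcy := Real.cosh_pos (dH 0 y / 2)
  have hcz := Real.cosh_pos (dH 0 z / 2)
  have hy1 : 1 - ‖y‖ ^ 2 = 1 / Real.cosh (dH 0 y / 2) ^ 2 := by rw [hny, one_sub_tanh_sq]
  have hz1 : 1 - ‖z‖ ^ 2 = 1 / Real.cosh (dH 0 z / 2) ^ 2 := by rw [hnz, one_sub_tanh_sq]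
  have hypos : 0 < ‖y‖ := by
    rw [hny, Real.tanh_eq_sinh_div_cosh]
    exact div_pos (Real.sinh_pos_iff.2 (by linarith)) hcy
  have h2 : ‖1 - ip z y‖ ^ 2 = (1 - ‖z‖ * ‖y‖) ^ 2 := by
    rw [h, coshSq, hy1, hz1, sub_div, Real.cosh_sub] at h1
    rw [hny, hnz, Real.tanh_eq_sinh_div_cosh, Real.tanh_eq_sinh_div_cosh]
    field_simp at h1 ⊢
    linarith
  have h3 : ‖1 - ip z y‖ = 1 - ‖z‖ * ‖y‖ :=
    (pow_left_inj₀ (norm_nonneg _) (by linarith [norm_mul_lt_one hz hy]) two_ne_zero).1 h2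
  have h4 : (1 - ip z y).re ≤ ‖1 - ip z y‖ := by
    have := real_inner_le_norm (1 - ip z y) (1 : ℍ[ℝ])
    rwa [Quaternion.inner_def, star_one, mul_one, norm_one, mul_one] at this
  have h5 : inner ℝ z y = ‖z‖ * ‖y‖ := by
    refine le_antisymm (real_inner_le_norm z y) ?_
    rw [Quaternion.re_sub, Quaternion.re_one, ip_re, h3] at h4
    linarith
  rw [inner_eq_norm_mul_iff_real] at h5
  rw [ray, ← hnz, smul_comm, ← h5, smul_smul, inv_mul_cancel₀ hypos.ne', one_smul]

theorem dH_self {z : HSpace n} (hz : z ∈ ball n) : dH z z = 0 := by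
  have h := one_sub_sq_pos hz
  have h2 : (1 : ℍ[ℝ]) - ip z z = ((1 - ‖z‖ ^ 2 : ℝ) : ℍ[ℝ]) := by rw [ip_self]; simp
  have h1 : coshSq z z = 1 := by
    rw [coshSq, h2, Quaternion.norm_coe, Real.norm_eq_abs, sq_abs, ← sq, div_self (by positivity)]
  rw [dH_eq, h1, Real.sqrt_one, (Real.arcosh_eq_zero_iff le_rfl).2 rfl, mul_zero]

theorem dH_Phi {u z w : HSpace n} (hu : u ∈ ball n) (hz : z ∈ ball n) (hw : w ∈ ball n) :
    dH (Phi u z) (Phi u w) = dH z w := by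
  rw [← act_huaSp hu, ← act_huaSp hu, dH_act _ hz hw]

theorem energyDensity_Phi {u z w : HSpace n} (hu : u ∈ ball n) (hz : z ∈ ball n)
    (hw : w ∈ ball n) : energyDensity (Phi u z) w = energyDensity z (Phi u w) := by
  rw [← energyDensity_act (huaSp u hu) hz (Phi_mem_ball hu hw), act_huaSp, act_huaSp, Phi_Phi hu hw]

/-- After `Φ_{γ a}` moves the initial point to the origin, each point of the segment is in the
equality case of the triangle inequality between `0` and the endpoint. -/
theorem IsGeodesicSegment.exists_eq_ray {γ : ℝ → HSpace n} {a b : ℝ} (hab : a < b)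
    (h : IsGeodesicSegment γ a b) : ∃ e : HSpace n, ‖e‖ = 1 ∧
      ∀ t ∈ Set.Icc a b, γ t = Phi (γ a) (ray e (t - a)) := by
  have ha : a ∈ Set.Icc a b := ⟨le_rfl, hab.le⟩
  have hb : b ∈ Set.Icc a b := ⟨hab.le, le_rfl⟩
  have hpa := h.1 a ha
  have hd : ∀ t ∈ Set.Icc a b, dH 0 (Phi (γ a) (γ t)) = t - a := by
    intro t ht
    rw [← Phi_self hpa, dH_Phi hpa hpa (h.1 t ht), h.2 a ha t ht, abs_sub_comm,
      abs_of_nonneg (by linarith [ht.1])]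
  have hyb := Phi_mem_ball hpa (h.1 b hb)
  refine ⟨‖Phi (γ a) (γ b)‖⁻¹ • Phi (γ a) (γ b), ?_, fun t ht => ?_⟩
  · have : Phi (γ a) (γ b) ≠ 0 := by
      intro h0
      have h1 := hd b hb
      rw [h0, dH_self zero_mem_ball] at h1
      linarith
    rw [norm_smul, norm_inv, norm_norm, inv_mul_cancel₀ (norm_ne_zero_iff.2 this)]
  · have hyt := Phi_mem_ball hpa (h.1 t ht)
    have h1 := eq_ray_of_dH_add hyb hyt (by rw [hd b hb]; linarith) (by
      rw [dH_Phi hpa (h.1 t ht) (h.1 b hb), h.2 t ht b hb, hd b hb, hd t ht, abs_sub_comm,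
        abs_of_nonneg (by linarith [ht.2])]
      ring)
    rw [hd t ht] at h1
    rw [← h1, Phi_Phi hpa (h.1 t ht)]

/-- From `log u ≤ u - 1`. This first-order upper bound with quadratic error replaces differentiation
under the integral when testing a minimiser. -/
theorem energyDensity_le_zero_add {z y : HSpace n} (hz : z ∈ ball n) (hy : y ∈ ball n) :
    energyDensity z y ≤
      energyDensity 0 y + (2 * ‖z‖ ^ 2 - 2 * inner ℝ z y) / (1 - ‖z‖ ^ 2) := by
  have hz' := one_sub_sq_pos hz
  have hp := norm_one_sub_ip_pos hz hy
  have h1 := norm_one_sub_smul_sq 1 (ip z y)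
  rw [one_smul, ip_re] at h1
  have h2 : ‖ip z y‖ ^ 2 ≤ ‖z‖ ^ 2 := by
    refine pow_le_pow_left₀ (norm_nonneg _) ((norm_ip_le z y).trans ?_) 2
    exact mul_le_of_le_one_right (norm_nonneg _) (mem_ball_iff.1 hy).le
  have h3 := Real.log_le_sub_one_of_pos (x := ‖1 - ip z y‖ ^ 2 / (1 - ‖z‖ ^ 2)) (by positivity)
  have h4 : ‖1 - ip z y‖ ^ 2 / (1 - ‖z‖ ^ 2) - 1 ≤
      (2 * ‖z‖ ^ 2 - 2 * inner ℝ z y) / (1 - ‖z‖ ^ 2) := by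
    rw [div_sub_one hz'.ne']
    refine div_le_div_of_nonneg_right ?_ hz'.le
    rw [h1]
    linarith
  rw [Real.log_div (by positivity) hz'.ne', Real.log_pow] at h3
  rw [energyDensity_eq hz hy, energyDensity_eq zero_mem_ball hy]
  simp only [ip_zero_left, sub_zero, norm_one, norm_zero, Real.log_one]
  push_cast at h3
  norm_num
  linarith

/-! ### The energy functional -/

theorem measurable_dH (x : HSpace n) : Measurable (dH x) := by
  have h : dH x = fun y => 2 * Real.arcosh (Real.sqrt (coshSq x y)) := funext fun y => dH_eq x y
  have hip : Continuous fun y => ip x y := by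
    have := (continuous_ip_left x).star
    simpa only [star_ip] using this
  have hc : Measurable fun y => coshSq x y := by
    unfold coshSq
    have := hip.measurable
    fun_prop
  rw [h]
  unfold Real.arcosh
  fun_prop

theorem measurable_energyDensity (x : HSpace n) : Measurable (energyDensity x) := by
  unfold energyDensity
  have := measurable_dH x
  fun_prop

variable {D : Set (HSpace n)}

theorem Admissible.isFiniteMeasure (hD : Admissible D) : IsFiniteMeasure ((Lam n).restrict D) :=
  ⟨by rw [Measure.restrict_apply_univ]; exact hD.finite⟩

theorem Admissible.nullMeasurableSet (hD : Admissible D) : NullMeasurableSet D (Lam n) :=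
  (nullMeasurableSet_volume_iff hD.subset_ball).1 hD.measurable

theorem Admissible.integral_lt (hD : Admissible D) {f g : HSpace n → ℝ}
    (hf : IntegrableOn f D (Lam n)) (hg : IntegrableOn g D (Lam n))
    (h : ∀ y ∈ ball n, f y < g y) : ∫ y in D, f y ∂(Lam n) < ∫ y in D, g y ∂(Lam n) := by
  have h1 : 0 < ∫ y in D, (g y - f y) ∂(Lam n) := by
    rw [integral_pos_iff_support_of_nonneg_ae (f := fun y => g y - f y) ?_ (hg.sub hf)]
    · have h2 : Function.support (fun y => g y - f y) =ᵐ[(Lam n).restrict D] Set.univ := by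
        filter_upwards [ae_restrict_of_ae ae_mem_ball] with y hy
        refine propext ⟨fun _ => trivial, fun _ => ?_⟩
        exact (sub_pos.2 (h y hy)).ne'
      rw [measure_congr h2, Measure.restrict_apply_univ]
      exact hD.pos
    · filter_upwards [ae_restrict_of_ae ae_mem_ball] with y hy using (sub_pos.2 (h y hy)).le
  rw [integral_sub hg hf] at h1
  linarith

theorem setIntegral_le_of_le_on_ball {f g : HSpace n → ℝ}
    (hf : IntegrableOn f D (Lam n)) (hg : IntegrableOn g D (Lam n))
    (h : ∀ y ∈ ball n, f y ≤ g y) : ∫ y in D, f y ∂(Lam n) ≤ ∫ y in D, g y ∂(Lam n) := by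
  refine integral_mono_ae hf hg ?_
  filter_upwards [ae_restrict_of_ae ae_mem_ball] with y hy using h y hy

theorem measurable_Phi {c : HSpace n} (hc : c ∈ ball n) : Measurable (Phi c) := by
  have : Phi c = act (huaSp c hc) := funext fun z => (act_huaSp hc z).symm
  rw [this]
  exact measurable_act _

theorem Admissible.integrableOn_Phi (hD : Admissible D) {c : HSpace n} (hc : c ∈ ball n) :
    IntegrableOn (Phi c) D (Lam n) := by
  have := hD.isFiniteMeasure
  refine Integrable.of_bound (measurable_Phi hc).aestronglyMeasurable 1 ?_
  filter_upwards [ae_restrict_of_ae ae_mem_ball] with y hy using (mem_ball_iff.1 (Phi_mem_ball hc hy)).le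

/-- The only term unbounded in `y` is `-log (1 - ‖y‖²)`, which is the energy density at the origin
and so at most `dH 0 y`. The bound serves both integrability and dominated convergence. -/
theorem energyDensity_le {x y : HSpace n} (hx : x ∈ ball n) (hy : y ∈ ball n) :
    energyDensity x y ≤ 2 * Real.log 2 - Real.log (1 - ‖x‖ ^ 2) + dH 0 y := by
  have h1 := energyDensity_le_dH zero_mem_ball hy
  have h2 := Real.log_le_log (norm_one_sub_ip_pos hx hy) (norm_one_sub_ip_le_two hx hy)
  rw [energyDensity_eq zero_mem_ball hy] at h1
  simp only [ip_zero_left, sub_zero, norm_one, norm_zero, Real.log_one] at h1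
  norm_num at h1
  rw [energyDensity_eq hx hy]
  linarith

theorem Admissible.integrableOn_energyDensity (hD : Admissible D) {x : HSpace n}
    (hx : x ∈ ball n) : IntegrableOn (energyDensity x) D (Lam n) := by
  have := hD.isFiniteMeasure
  refine Integrable.mono' ((integrable_const (2 * Real.log 2 - Real.log (1 - ‖x‖ ^ 2))).add hD.moment)
    (measurable_energyDensity x).aestronglyMeasurable ?_
  filter_upwards [ae_restrict_of_ae ae_mem_ball] with y hy
  rw [Real.norm_eq_abs, abs_of_nonneg (energyDensity_nonneg hx hy)]
  exact energyDensity_le hx hy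

theorem Admissible.strictGeodesicallyConvex_energy (hD : Admissible D) :
    StrictGeodesicallyConvex (energy D) := by
  intro γ a b hab hγ
  obtain ⟨e, he, hray⟩ := hγ.exists_eq_ray hab
  have hpa := hγ.1 a ⟨le_rfl, hab.le⟩
  refine ⟨convex_Icc a b, fun s hs t ht hst p q hp hq hpq => ?_⟩
  have hw : p • s + q • t ∈ Set.Icc a b := convex_Icc a b hs ht hp.le hq.le hpq
  have key : ∀ y ∈ ball n, energyDensity (γ (p • s + q • t)) y <
      p * energyDensity (γ s) y + q * energyDensity (γ t) y := by
    intro y hy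
    have hc := (strictConvexOn_energyDensity_ray he (Phi_mem_ball hpa hy)).2 (Set.mem_univ (s - a))
      (Set.mem_univ (t - a)) (fun h => hst (sub_left_injective h)) hp hq hpq
    have hwa : p • (s - a) + q • (t - a) = p • s + q • t - a := by
      have : q = 1 - p := by linarith
      simp only [smul_eq_mul, this]
      ring
    rw [hray _ hw, hray s hs, hray t ht, energyDensity_Phi hpa (ray_mem_ball he _) hy,
      energyDensity_Phi hpa (ray_mem_ball he _) hy, energyDensity_Phi hpa (ray_mem_ball he _) hy,
      ← hwa]
    exact hc
  have is := hD.integrableOn_energyDensity (hγ.1 s hs)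
  have it := hD.integrableOn_energyDensity (hγ.1 t ht)
  have h := hD.integral_lt (hD.integrableOn_energyDensity (hγ.1 _ hw))
    ((is.const_mul p).add (it.const_mul q)) key
  simp only [Pi.add_apply] at h
  rwa [integral_add (is.const_mul p) (it.const_mul q), integral_const_mul, integral_const_mul] at h

theorem Admissible.integral_inner_Phi (hD : Admissible D) {c : HSpace n} (hc : c ∈ ball n)
    (z : HSpace n) : ∫ y in D, inner ℝ z (Phi c y) ∂(Lam n) =
      inner ℝ z (∫ y in D, Phi c y ∂(Lam n)) :=
  integral_inner (hD.integrableOn_Phi hc) z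

theorem Admissible.integrableOn_inner_Phi (hD : Admissible D) {c : HSpace n} (hc : c ∈ ball n)
    (z : HSpace n) : IntegrableOn (fun y => inner ℝ z (Phi c y)) D (Lam n) :=
  (hD.integrableOn_Phi hc).const_inner z

theorem Admissible.energy_lt_of_isBarycenter (hD : Admissible D) {c x : HSpace n}
    (hc : IsBarycenter D c) (hx : x ∈ ball n) (hxc : x ≠ c) : energy D c < energy D x := by
  obtain ⟨hcb, hc0⟩ := hc
  set z := Phi c x with hz
  have hzb : z ∈ ball n := Phi_mem_ball hcb hx
  have hxz : x = Phi c z := (Phi_Phi hcb hx).symm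
  have hz0 : z ≠ 0 := fun h => hxc (by rw [hxz, h, Phi_zero])
  have hn : 0 < ‖z‖ := norm_pos_iff.2 hz0
  set e := ‖z‖⁻¹ • z with he
  have he1 : ‖e‖ = 1 := by rw [he, norm_smul, norm_inv, norm_norm, inv_mul_cancel₀ hn.ne']
  -- The hyperbolic distance from the origin to `z`, so that `z` is the point of the ray at
  -- parameter `t`.
  set t := 2 * Real.artanh ‖z‖ with ht
  have ht0 : t ≠ 0 := (mul_pos two_pos (Real.artanh_pos ⟨hn, mem_ball_iff.1 hzb⟩)).ne'
  have hzr : z = ray e t := by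
    rw [ray, ht, mul_div_cancel_left₀ _ (two_ne_zero),
      Real.tanh_artanh ⟨by linarith, mem_ball_iff.1 hzb⟩, he, smul_smul, mul_inv_cancel₀ hn.ne',
      one_smul]
  have key : ∀ y ∈ ball n, energyDensity c y - t * inner ℝ e (Phi c y) < energyDensity x y := by
    intro y hy
    have h := energyDensity_ray_gt he1 (Phi_mem_ball hcb hy) ht0
    rw [← hzr, ← energyDensity_Phi hcb hzb hy, ← hxz, ← energyDensity_Phi hcb zero_mem_ball hy,
      Phi_zero] at h
    exact h
  have i1 := hD.integrableOn_energyDensity hcb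
  have i2 := (hD.integrableOn_inner_Phi hcb e).const_mul t
  have h := hD.integral_lt (i1.sub i2) (hD.integrableOn_energyDensity hx) key
  simp only [Pi.sub_apply] at h
  rwa [integral_sub i1 i2, integral_const_mul, hD.integral_inner_Phi hcb, hc0, inner_zero_right,
    mul_zero, sub_zero] at h

theorem Admissible.isBarycenter_of_isMinOn (hD : Admissible D) {c : HSpace n} (hcb : c ∈ ball n)
    (hmin : ∀ x ∈ ball n, energy D c ≤ energy D x) : IsBarycenter D c := by
  have hfin := hD.isFiniteMeasure
  refine ⟨hcb, ?_⟩
  set m := ∫ y in D, Phi c y ∂(Lam n) with hm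
  set M := (Lam n).real D with hM
  have hM0 : 0 ≤ M := measureReal_nonneg
  -- First-order optimality: a linear form in `z` bounded by a quadratic one near the origin must
  -- vanish.
  have key : ∀ z ∈ ball n, inner ℝ z m ≤ ‖z‖ ^ 2 * M := by
    intro z hz
    have hz' := one_sub_sq_pos hz
    have i1 := hD.integrableOn_energyDensity hcb
    have i2 : IntegrableOn (fun y => (2 * ‖z‖ ^ 2 - 2 * inner ℝ z (Phi c y)) / (1 - ‖z‖ ^ 2)) D
        (Lam n) :=
      ((integrable_const _).sub ((hD.integrableOn_inner_Phi hcb z).const_mul 2)).div_const _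
    have h1 := setIntegral_le_of_le_on_ball (hD.integrableOn_energyDensity (Phi_mem_ball hcb hz)) (i1.add i2) (by
      intro y hy
      have := energyDensity_le_zero_add hz (Phi_mem_ball hcb hy)
      rwa [← energyDensity_Phi hcb hz hy, ← energyDensity_Phi hcb zero_mem_ball hy, Phi_zero]
        at this)
    have h2 := hmin _ (Phi_mem_ball hcb hz)
    simp only [Pi.add_apply] at h1
    rw [integral_add i1 i2, integral_div, integral_sub (integrable_const _)
      ((hD.integrableOn_inner_Phi hcb z).const_mul 2), integral_const, integral_const_mul,
      hD.integral_inner_Phi hcb, measureReal_restrict_apply_univ, ← hM, ← hm,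
      smul_eq_mul] at h1
    have h3 : 0 ≤ (M * (2 * ‖z‖ ^ 2) - 2 * inner ℝ z m) / (1 - ‖z‖ ^ 2) := by
      rw [energy, energy] at h2
      linarith
    rw [le_div_iff₀ hz', zero_mul] at h3
    linarith
  by_contra hm0
  have hmp : 0 < ‖m‖ := norm_pos_iff.2 hm0
  -- This choice makes both `ε ‖m‖ < 1`, so that `ε • m` lies in the ball, and `ε M < 1`, which
  -- contradicts `key` at that point.
  set ε := (1 + ‖m‖ + M)⁻¹ with hε
  have hs : 0 < 1 + ‖m‖ + M := by positivity
  have hε0 : 0 < ε := inv_pos.2 hs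
  have hεe : ε * (1 + ‖m‖ + M) = 1 := inv_mul_cancel₀ hs.ne'
  have hb : ε • m ∈ ball n := by
    rw [mem_ball_iff, norm_smul, Real.norm_eq_abs, abs_of_pos hε0]
    nlinarith
  have h := key _ hb
  rw [norm_smul, real_inner_smul_left, real_inner_self_eq_norm_sq, Real.norm_eq_abs,
    abs_of_pos hε0] at h
  have h1 : 0 < ε * ‖m‖ ^ 2 := by positivity
  have h2 : 1 ≤ ε * M := by
    refine le_of_mul_le_mul_left ?_ h1
    linarith
  nlinarith

/-! ### Continuity, growth at the boundary and existence of a minimiser -/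

theorem continuousAt_coshSq_left {x y : HSpace n} (hx : x ∈ ball n) (hy : y ∈ ball n) :
    ContinuousAt (fun z => coshSq z y) x := by
  have h1 := (one_sub_sq_pos hx).ne'
  have h2 := (one_sub_sq_pos hy).ne'
  have h3 := continuous_ip_left y
  unfold coshSq
  refine ContinuousAt.div ?_ ?_ (mul_ne_zero h1 h2) <;> fun_prop

theorem Admissible.continuousOn_energy (hD : Admissible D) : ContinuousOn (energy D) (ball n) := by
  intro x hx
  refine ContinuousAt.continuousWithinAt ?_
  have hfin := hD.isFiniteMeasure
  have hx1 := mem_ball_iff.1 hx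
  obtain ⟨r, hxr, hr1⟩ := exists_between hx1
  have hr0 : 0 < r := (norm_nonneg x).trans_lt hxr
  have hnhds : ∀ᶠ z in nhds x, ‖z‖ < r := continuous_norm.continuousAt.eventually_lt_const hxr
  refine continuousAt_of_dominated
    (bound := fun y => (2 * Real.log 2 - Real.log (1 - r ^ 2)) + dH 0 y) ?_ ?_
    ((integrable_const _).add hD.moment) ?_
  · exact Filter.Eventually.of_forall fun z => (measurable_energyDensity z).aestronglyMeasurable
  · filter_upwards [hnhds] with z hz
    filter_upwards [ae_restrict_of_ae ae_mem_ball] with y hy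
    have hzb : z ∈ ball n := mem_ball_iff.2 (hz.trans hr1)
    rw [Real.norm_eq_abs, abs_of_nonneg (energyDensity_nonneg hzb hy)]
    have h1 := energyDensity_le hzb hy
    have h2 : Real.log (1 - r ^ 2) ≤ Real.log (1 - ‖z‖ ^ 2) := by
      refine Real.log_le_log (by nlinarith) ?_
      nlinarith [norm_nonneg z]
    linarith
  · filter_upwards [ae_restrict_of_ae ae_mem_ball] with y hy
    have h1 : ContinuousAt (fun z => Real.log (coshSq z y)) x :=
      (continuousAt_coshSq_left hx hy).log (by linarith [one_le_coshSq hx hy])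
    refine h1.congr_of_eventuallyEq ?_
    filter_upwards [ball_mem_nhds hx] with z hz using energyDensity_eq_log hz hy

theorem Admissible.exists_inter_closedBall_pos (hD : Admissible D) :
    ∃ r : ℝ, 0 ≤ r ∧ r < 1 ∧ 0 < Lam n (D ∩ Metric.closedBall 0 r) := by
  by_contra! h
  have h1 : D ⊆ ⋃ k : ℕ, D ∩ Metric.closedBall 0 (1 - 1 / ((k : ℝ) + 1)) := by
    intro y hy
    have hy1 := mem_ball_iff.1 (hD.subset_ball hy)
    obtain ⟨k, hk⟩ := exists_nat_one_div_lt (sub_pos.2 hy1)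
    refine Set.mem_iUnion.2 ⟨k, hy, ?_⟩
    rw [mem_closedBall_zero_iff]
    linarith
  refine hD.pos.ne' (measure_mono_null h1 (measure_iUnion_null fun k => ?_))
  have hk : (0 : ℝ) < (k : ℝ) + 1 := by positivity
  refine nonpos_iff_eq_zero.1 (h _ ?_ ?_)
  · rw [sub_nonneg, div_le_one hk]
    linarith [(Nat.cast_nonneg k : (0 : ℝ) ≤ k)]
  · linarith [one_div_pos.2 hk]

theorem energyDensity_ge {x y : HSpace n} {r : ℝ} (hx : x ∈ ball n) (hy : y ∈ ball n) (hr : r < 1)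
    (hyr : ‖y‖ ≤ r) : 2 * Real.log (1 - r) - Real.log (1 - ‖x‖ ^ 2) ≤ energyDensity x y := by
  have h1 : Real.log (1 - r) ≤ Real.log ‖1 - ip x y‖ := by
    refine Real.log_le_log (by linarith) ?_
    have := one_sub_norm_ip_le x y
    nlinarith [norm_nonneg x, norm_nonneg y, mem_ball_iff.1 hx]
  have h2 : Real.log (1 - ‖y‖ ^ 2) ≤ 0 :=
    Real.log_nonpos (one_sub_sq_pos hy).le (by nlinarith [norm_nonneg y])
  rw [energyDensity_eq hx hy]
  linarith

/-- The density is nonnegative, so the part of `D` outside the closed ball may be dropped. If the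
remaining mass is positive, the bound tends to infinity as `‖x‖ → 1`. -/
theorem Admissible.energy_ge (hD : Admissible D) {x : HSpace n} {r : ℝ} (hx : x ∈ ball n)
    (hr : r < 1) : (Lam n).real (D ∩ Metric.closedBall 0 r) *
      (2 * Real.log (1 - r) - Real.log (1 - ‖x‖ ^ 2)) ≤ energy D x := by
  have hfin : Lam n (D ∩ Metric.closedBall 0 r) ≠ ⊤ :=
    ((measure_mono Set.inter_subset_left).trans_lt hD.finite).ne
  have hm : NullMeasurableSet (D ∩ Metric.closedBall 0 r) (Lam n) :=
    hD.nullMeasurableSet.inter Metric.isClosed_closedBall.nullMeasurableSet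
  have h1 : ∫ y in D ∩ Metric.closedBall 0 r, energyDensity x y ∂(Lam n) ≤ energy D x := by
    refine setIntegral_mono_set (hD.integrableOn_energyDensity hx) ?_
      (Filter.Eventually.of_forall fun y hy => hy.1)
    filter_upwards [ae_restrict_of_ae ae_mem_ball] with y hy using energyDensity_nonneg hx hy
  refine le_trans ?_ h1
  rw [← smul_eq_mul, ← setIntegral_const]
  refine setIntegral_mono_on₀ (integrableOn_const hfin)
    ((hD.integrableOn_energyDensity hx).mono_set Set.inter_subset_left) hm fun y hy => ?_
  exact energyDensity_ge hx (hD.subset_ball hy.1) hr (mem_closedBall_zero_iff.1 hy.2)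

theorem Admissible.exists_minimizer (hD : Admissible D) :
    ∃ c ∈ ball n, ∀ x ∈ ball n, energy D c ≤ energy D x := by
  obtain ⟨r, -, hr1, hpos⟩ := hD.exists_inter_closedBall_pos
  set m := (Lam n).real (D ∩ Metric.closedBall 0 r) with hm
  have hm0 : 0 < m := ENNReal.toReal_pos hpos.ne'
    ((measure_mono Set.inter_subset_left).trans_lt hD.finite).ne
  -- The exponential is where the lower bound of `Admissible.energy_ge` equals `energy D 0`; points
  -- with `1 - ‖x‖² < δ` therefore cannot beat the origin.
  set δ := min (Real.exp (2 * Real.log (1 - r) - energy D 0 / m)) (1 / 2) with hδ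
  have hδ0 : 0 < δ := lt_min (Real.exp_pos _) (by norm_num)
  have hδ1 : δ < 1 := (min_le_right _ _).trans_lt (by norm_num)
  have hsub : Metric.closedBall (0 : HSpace n) (Real.sqrt (1 - δ)) ⊆ ball n := by
    intro x hx
    rw [mem_closedBall_zero_iff] at hx
    rw [mem_ball_iff]
    refine hx.trans_lt ?_
    rw [Real.sqrt_lt' one_pos]
    linarith
  obtain ⟨c, hc, hmin⟩ := (isCompact_closedBall (0 : HSpace n) (Real.sqrt (1 - δ))).exists_isMinOn
    ⟨0, by simp⟩ (hD.continuousOn_energy.mono hsub)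
  refine ⟨c, hsub hc, fun x hx => ?_⟩
  by_cases hxK : x ∈ Metric.closedBall (0 : HSpace n) (Real.sqrt (1 - δ))
  · exact hmin hxK
  · have h0 : energy D c ≤ energy D 0 := hmin (by simp)
    refine h0.trans (le_trans ?_ (hD.energy_ge (r := r) hx hr1))
    have hx1 := one_sub_sq_pos hx
    have h1 : 1 - ‖x‖ ^ 2 < δ := by
      rw [mem_closedBall_zero_iff, not_le] at hxK
      rw [Real.sqrt_lt' ((Real.sqrt_nonneg _).trans_lt hxK)] at hxK
      linarith
    have h2 : Real.log (1 - ‖x‖ ^ 2) ≤ 2 * Real.log (1 - r) - energy D 0 / m := by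
      rw [Real.log_le_iff_le_exp hx1]
      exact h1.le.trans (min_le_left _ _)
    have h3 : energy D 0 / m ≤ 2 * Real.log (1 - r) - Real.log (1 - ‖x‖ ^ 2) := by linarith
    rwa [div_le_iff₀' hm0] at h3

/-! ### Uniqueness and equivariance -/

theorem Admissible.image_act (hD : Admissible D) (g : Sp n) : Admissible (act g '' D) := by
  have hsub : act g '' D ⊆ ball n := by
    rintro _ ⟨x, hx, rfl⟩
    exact act_mem_ball g (hD.subset_ball hx)
  have hmp := measurePreserving_act_restrict g hD.subset_ball hD.nullMeasurableSet
  have hmass : Lam n (act g '' D) = Lam n D := by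
    have := hmp.measure_preimage (s := Set.univ) MeasurableSet.univ.nullMeasurableSet
    simpa using this.symm
  refine ⟨hsub, (nullMeasurableSet_volume_iff hsub).2
    (nullMeasurableSet_image_act g hD.subset_ball hD.nullMeasurableSet), hmass ▸ hD.pos,
    hmass ▸ hD.finite, ?_⟩
  have hfin := hD.isFiniteMeasure
  rw [IntegrableOn, ← hmp.integrable_comp (measurable_dH 0).aestronglyMeasurable]
  have h0 : act g⁻¹ 0 ∈ ball n := act_mem_ball _ zero_mem_ball
  refine Integrable.mono' ((hD.integrableOn_energyDensity h0).add
    (integrable_const (2 * Real.log 2)))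
    ((measurable_dH 0).comp (measurable_act g)).aestronglyMeasurable ?_
  filter_upwards [ae_restrict_of_ae ae_mem_ball] with y hy
  have h1 := dH_nonneg zero_mem_ball (act_mem_ball g hy)
  rw [Function.comp_apply, Real.norm_eq_abs, abs_of_nonneg h1]
  -- Moving the base point instead of the set, the moment of the image is controlled by the
  -- integrable energy density based at `g⁻¹(0)`.
  have h2 : dH 0 (act g y) = dH (act g⁻¹ 0) y := by
    rw [← dH_act g h0 hy, act_act_inv g zero_mem_ball]
  rw [h2]
  exact dH_le_energyDensity

theorem Admissible.energy_image_act (hD : Admissible D) (g : Sp n) {x : HSpace n}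
    (hx : x ∈ ball n) : energy (act g '' D) (act g x) = energy D x := by
  have hmp := measurePreserving_act_restrict g hD.subset_ball hD.nullMeasurableSet
  rw [energy, ← hmp.map_eq, integral_map hmp.measurable.aemeasurable
    (measurable_energyDensity _).aestronglyMeasurable, energy]
  refine integral_congr_ae ?_
  filter_upwards [ae_restrict_of_ae ae_mem_ball] with y hy using energyDensity_act g hx hy

theorem Admissible.isBarycenter_unique (hD : Admissible D) {c c' : HSpace n}
    (hc : IsBarycenter D c) (hc' : IsBarycenter D c') : c' = c := by
  by_contra h
  exact lt_asymm (hD.energy_lt_of_isBarycenter hc hc'.1 h)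
    (hD.energy_lt_of_isBarycenter hc' hc.1 (Ne.symm h))

/-- Minimisers of the energy go to minimisers, and these are barycenters; no formula relating `Φ_{g
c} ∘ g` to `Φ_c` is needed. -/
theorem Admissible.isBarycenter_image_act (hD : Admissible D) (g : Sp n) {c : HSpace n}
    (hc : IsBarycenter D c) : IsBarycenter (act g '' D) (act g c) := by
  refine (hD.image_act g).isBarycenter_of_isMinOn (act_mem_ball g hc.1) fun x hx => ?_
  have hx' := act_mem_ball g⁻¹ hx
  rw [← act_act_inv g hx, hD.energy_image_act g hc.1, hD.energy_image_act g hx']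
  by_cases h : act g⁻¹ x = c
  · rw [h]
  · exact (hD.energy_lt_of_isBarycenter hc hx' h).le

end QHyp

end

theorem theorem1p1 (n : ℕ) (D : Set (QHyp.HSpace n)) (hD : QHyp.Admissible D) :
    -- the two integrals are well defined
    (∀ c ∈ QHyp.ball n, IntegrableOn (QHyp.Phi c) D (QHyp.Lam n)) ∧
    (∀ x ∈ QHyp.ball n, IntegrableOn (QHyp.energyDensity x) D (QHyp.Lam n)) ∧
    -- the energy is strictly geodesically convex
    QHyp.StrictGeodesicallyConvex (QHyp.energy D) ∧
    -- existence and uniqueness of the barycenter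
    ∃ c : QHyp.HSpace n, (QHyp.IsBarycenter D c ∧ ∀ c', QHyp.IsBarycenter D c' → c' = c) ∧
      -- it is the unique global minimiser of the energy on the ball
      (∀ x ∈ QHyp.ball n, x ≠ c → QHyp.energy D c < QHyp.energy D x) ∧
      -- for every `g`, the set `g(D)` is admissible and its unique barycenter is `g(c)`
      ∀ g : QHyp.Sp n, QHyp.Admissible (QHyp.act g '' D) ∧
        QHyp.IsBarycenter (QHyp.act g '' D) (QHyp.act g c) ∧
        ∀ c', QHyp.IsBarycenter (QHyp.act g '' D) c' → c' = QHyp.act g c := by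
  refine ⟨fun c hc => hD.integrableOn_Phi hc, fun x hx => hD.integrableOn_energyDensity hx,
    hD.strictGeodesicallyConvex_energy, ?_⟩
  obtain ⟨c, hcb, hmin⟩ := hD.exists_minimizer
  have hc := hD.isBarycenter_of_isMinOn hcb hmin
  refine ⟨c, ⟨hc, fun c' hc' => hD.isBarycenter_unique hc hc'⟩,
    fun x hx hxc => hD.energy_lt_of_isBarycenter hc hx hxc, fun g => ?_⟩
  have hg := hD.isBarycenter_image_act g hc
  exact ⟨hD.image_act g, hg, fun c' hc' => (hD.image_act g).isBarycenter_unique hg hc'⟩
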